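/- All rings are commutative with $1$. Let $A$ be a noetherian ring with an ideal $\mathfrak o(A)\neq A$ such that $A$ is $\mathfrak o(A)$-adically complete and separated, i.e. $\bigcap_e\mathfrak o(A)^e=\{0\}$. For $Y=(Y_1,\dots,Y_n)$, $n\ge 0$, let $A\langle Y\rangle\subseteq A[[Y]]$ be the ring of series $\sum_\nu a_\nu Y^\nu$ with $a_\nu\to 0$ in the $\mathfrak o(A)$-adic topology as $|\nu|\to\infty$. An *$A$-analytic structure* on a ring $R$ is a family of ring morphisms $\iota_n$ from $A\langle Y_1,\dots,Y_n\rangle$ to the ring of functions $R^n\to R$ ($n=0,1,2,\dots$; we write $f(y)$ for $\iota_n(f)(y)$) such that $\iota_n(Y_k)(y)=y_k$; $\iota_n(f)(y_1,\dots,y_n)=\iota_{n+1}(f)(y_1,\dots,y_{n+1})$ for $f\in A\langle Y_1,\dots,Y_n\rangle$; and $\iota_n(f)(y_{n+1},\dots,y_{2n})=\iota_{2n}\big(f(Y_{n+1},\dots,Y_{2n})\big)(y_1,\dots,y_{2n})$ for $f\in A\langle Y_1,\dots,Y_n\rangle$. In particular $\iota_0$ is a ring morphism $A\to R$. A *valuation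 $A$-ring* is a valuation ring $R$ equipped with an $A$-analytic structure; it is *viable* if the ideal $\mathfrak o(A)R$ generated by $\iota_0(\mathfrak o(A))$ equals the maximal ideal of $R$ and is nonzero. Let $R$ be a viable valuation $A$-ring with fraction field $K$. For $f=\sum_\nu f_\nu(X)Y^\nu\in A\langle X,Y\rangle$ with $X=(X_1,\dots,X_m)$ and $x\in R^m$ put $f(x,Y)=\sum_\nu f_\nu(x)Y^\nu\in R[[Y]]$. Let $R\langle Y\rangle\subseteq R[[Y]]$ be the ring of all such series $f(x,Y)$, with $m$ ranging over $\mathbb N$, and let $K\langle Y\rangle=\{c^{-1}g:\ c\in R\setminus\{0\},\ g\in R\langle Y\rangle\}\subseteq K[[Y]]$. **Theorem.** $K\langle Y\rangle$ is an integral domain and (i) $K\langle Y\rangle$ is noetherian. Moreover, for every proper ideal $I$ of $K\langle Y\rangle$: (ii) there are $m\le n$ and an injective $K$-algebra morphism $K\langle Y_1,\dots,Y_m\rangle\to K\langle Y\rangle/I$ making $K\langle Y\rangle/I$ a finitely generated $K\langle Y_1,\dots,Y_m\rangle$-module; (iii) for every algebraically closed valued field extension $K^{\rm a}$ of $K$ whose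 valuation ring $R^{\rm a}$ is equipped with an $A$-analytic structure extending that of $R$, there is $y\in(R^{\rm a})^n$ such that $f(y)=0$ for all $f\in I$. Here $f$ is viewed in $K^{\rm a}\langle Y\rangle$, and the value at $y$ of $g=c^{-1}h(x,Y)\in K^{\rm a}\langle Y\rangle$ (with $c\in R^{\rm a}\setminus\{0\}$, $h\in A\langle X,Y\rangle$, $x\in(R^{\rm a})^m$) is $g(y)=c^{-1}h(x,y)\in K^{\rm a}$. -/

import Mathlib

namespace AnalyticRing

open MvPowerSeries

section RestrictedSeries

variable {A : Type*} [CommRing A]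

/-- The ring `A⟨Y₁, …, Yₙ⟩` of restricted power series: the coefficients tend to `0` in the
`𝔬`-adic topology of `A`, that is, for every `e` only finitely many of them lie outside `𝔬 ^ e`. -/
def restricted (𝔬 : Ideal A) (n : ℕ) : Subring (MvPowerSeries (Fin n) A) where
  carrier := {f | ∀ e : ℕ, {ν : Fin n →₀ ℕ | coeff ν f ∉ 𝔬 ^ e}.Finite}
  zero_mem' e := by simp
  one_mem' e := by
    classical
    refine (Set.finite_singleton (0 : Fin n →₀ ℕ)).subset fun ν hν => ?_
    by_contra h
    refine hν ?_
    rw [coeff_one, if_neg (by simpa using h)]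
    exact zero_mem _
  add_mem' {f g} hf hg e := by
    refine ((hf e).union (hg e)).subset fun ν hν => ?_
    by_contra h
    simp only [Set.mem_union, Set.mem_ofPred_eq, not_or, not_not] at h
    exact hν (by rw [map_add]; exact add_mem h.1 h.2)
  neg_mem' {f} hf e := by
    refine (hf e).subset fun ν hν h => hν ?_
    rw [map_neg]
    exact neg_mem h
  mul_mem' {f g} hf hg e := by
    classical
    refine ((hf e).add (hg e)).subset fun ν hν => ?_
    by_contra h
    refine hν ?_
    rw [coeff_mul]
    refine Ideal.sum_mem _ fun p hp => ?_
    by_cases h1 : coeff p.1 f ∈ 𝔬 ^ e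
    · exact Ideal.mul_mem_right _ _ h1
    · by_cases h2 : coeff p.2 g ∈ 𝔬 ^ e
      · exact Ideal.mul_mem_left _ _ h2
      · exact absurd ⟨p.1, h1, p.2, h2, Finset.HasAntidiagonal.mem_antidiagonal.1 hp⟩ h

lemma C_mem_restricted (𝔬 : Ideal A) (n : ℕ) (a : A) :
    (C a : MvPowerSeries (Fin n) A) ∈ restricted 𝔬 n := by
  classical
  intro e
  refine (Set.finite_singleton (0 : Fin n →₀ ℕ)).subset fun ν hν => ?_
  by_contra h
  refine hν ?_
  rw [coeff_C, if_neg (by simpa using h)]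
  exact zero_mem _

lemma X_mem_restricted (𝔬 : Ideal A) (n : ℕ) (k : Fin n) :
    (X k : MvPowerSeries (Fin n) A) ∈ restricted 𝔬 n := by
  classical
  intro e
  refine (Set.finite_singleton (Finsupp.single k 1)).subset fun ν hν => ?_
  by_contra h
  refine hν ?_
  rw [coeff_X, if_neg (by simpa using h)]
  exact zero_mem _

/-- The constants in `A⟨Y₁, …, Yₙ⟩`. -/
noncomputable def constants (𝔬 : Ideal A) (n : ℕ) : A →+* restricted 𝔬 n :=
  (C : A →+* MvPowerSeries (Fin n) A).codRestrict _ (C_mem_restricted 𝔬 n)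

/-- The indeterminate `Y_k` in `A⟨Y₁, …, Yₙ⟩`. -/
noncomputable def indet (𝔬 : Ideal A) {n : ℕ} (k : Fin n) : restricted 𝔬 n :=
  ⟨X k, X_mem_restricted 𝔬 n k⟩

lemma rename_mem_restricted {𝔬 : Ideal A} {m n : ℕ} (e : Fin m ↪ Fin n)
    {f : MvPowerSeries (Fin m) A} (hf : f ∈ restricted 𝔬 m) : rename e f ∈ restricted 𝔬 n := by
  intro k
  refine ((hf k).image (Finsupp.embDomain e)).subset fun ν hν => ?_
  by_cases h : ν ∈ Set.range (Finsupp.mapDomain e)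
  · obtain ⟨μ, rfl⟩ := h
    refine ⟨μ, fun hμ => hν ?_, Finsupp.embDomain_eq_mapDomain e μ⟩
    rw [← Finsupp.embDomain_eq_mapDomain, coeff_embDomain_rename]
    exact hμ
  · refine absurd ?_ hν
    rw [coeff_rename_eq_zero _ _ h]
    exact zero_mem _

/-- Renaming the indeterminates, `f(Y₁, …, Yₘ) ↦ f(Y_{e 1}, …, Y_{e m})`. -/
noncomputable def renameVars (𝔬 : Ideal A) {m n : ℕ} (e : Fin m ↪ Fin n) :
    restricted 𝔬 m →+* restricted 𝔬 n :=
  ((rename (R := A) e : _ →ₐ[A] _).toRingHom.comp (restricted 𝔬 m).subtype).codRestrict _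
    fun f => rename_mem_restricted e f.2

/-- The exponent of the monomial `X ^ μ * Y ^ ν`, where `X = (X₁, …, Xₘ)` are the first `m` and
`Y = (Y₁, …, Yₙ)` the last `n` of the `m + n` indeterminates. -/
noncomputable def joinExp {m n : ℕ} (μ : Fin m →₀ ℕ) (ν : Fin n →₀ ℕ) : Fin (m + n) →₀ ℕ :=
  Finsupp.equivFunOnFinite.symm (Fin.append μ ν)

lemma joinExp_add {m n : ℕ} (μ μ' : Fin m →₀ ℕ) (ν ν' : Fin n →₀ ℕ) :
    joinExp (μ + μ') (ν + ν') = joinExp μ ν + joinExp μ' ν' := by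
  ext i
  refine Fin.addCases (fun i => ?_) (fun i => ?_) i <;> simp [joinExp]

lemma joinExp_inj {m n : ℕ} {μ μ' : Fin m →₀ ℕ} {ν ν' : Fin n →₀ ℕ} :
    joinExp μ ν = joinExp μ' ν' ↔ μ = μ' ∧ ν = ν' := by
  refine ⟨fun h => ⟨?_, ?_⟩, fun h => by rw [h.1, h.2]⟩
  · ext i
    simpa [joinExp] using DFunLike.congr_fun h (Fin.castAdd n i)
  · ext i
    simpa [joinExp] using DFunLike.congr_fun h (Fin.natAdd m i)

lemma exists_joinExp {m n : ℕ} (a : Fin (m + n) →₀ ℕ) :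
    ∃ (μ : Fin m →₀ ℕ) (ν : Fin n →₀ ℕ), joinExp μ ν = a := by
  refine ⟨Finsupp.equivFunOnFinite.symm fun i => a (Fin.castAdd n i),
    Finsupp.equivFunOnFinite.symm fun i => a (Fin.natAdd m i), ?_⟩
  ext i
  refine Fin.addCases (fun i => ?_) (fun i => ?_) i <;> simp [joinExp]

/-- For `f = ∑_ν f_ν(X) Y ^ ν` in `A⟨X, Y⟩`, the coefficient `f_ν` as a power series. -/
noncomputable def sliceSeries {m n : ℕ} (f : MvPowerSeries (Fin (m + n)) A) (ν : Fin n →₀ ℕ) :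
    MvPowerSeries (Fin m) A :=
  fun μ => coeff (joinExp μ ν) f

lemma coeff_sliceSeries {m n : ℕ} (f : MvPowerSeries (Fin (m + n)) A) (ν : Fin n →₀ ℕ)
    (μ : Fin m →₀ ℕ) : coeff μ (sliceSeries f ν) = coeff (joinExp μ ν) f := rfl

/-- For `f = ∑_ν f_ν(X) Y ^ ν` in `A⟨X, Y⟩`, the coefficient `f_ν ∈ A⟨X⟩`. -/
noncomputable def slice {𝔬 : Ideal A} {m n : ℕ} (f : restricted 𝔬 (m + n)) (ν : Fin n →₀ ℕ) :
    restricted 𝔬 m :=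
  ⟨sliceSeries f ν, fun e =>
    Set.Finite.preimage (s := {κ | coeff κ f.1 ∉ 𝔬 ^ e}) (f := fun μ => joinExp μ ν)
      (fun _ _ _ _ h => (joinExp_inj.1 h).1) (f.2 e)⟩

lemma slice_add {𝔬 : Ideal A} {m n : ℕ} (f g : restricted 𝔬 (m + n)) (ν : Fin n →₀ ℕ) :
    slice (f + g) ν = slice f ν + slice g ν := rfl

lemma slice_mul {𝔬 : Ideal A} {m n : ℕ} (f g : restricted 𝔬 (m + n)) (ν : Fin n →₀ ℕ) :
    slice (f * g) ν = ∑ p ∈ Finset.HasAntidiagonal.antidiagonal ν, slice f p.1 * slice g p.2 := by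
  classical
  apply Subtype.ext
  ext μ
  rw [AddSubmonoidClass.coe_finsetSum, map_sum]
  simp only [Subring.coe_mul, slice, coeff_sliceSeries, coeff_mul]
  rw [← Finset.sum_product']
  symm
  refine Finset.sum_bij (fun p _ => (joinExp p.2.1 p.1.1, joinExp p.2.2 p.1.2)) ?_ ?_ ?_ ?_
  · rintro ⟨⟨a, b⟩, c, d⟩ h
    simp only [Finset.mem_product, Finset.HasAntidiagonal.mem_antidiagonal] at h ⊢
    rw [← joinExp_add, h.1, h.2]
  · rintro ⟨⟨a, b⟩, c, d⟩ - ⟨⟨a', b'⟩, c', d'⟩ - h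
    simp only [Prod.mk.injEq, joinExp_inj] at h ⊢
    tauto
  · rintro ⟨u, v⟩ h
    obtain ⟨c, a, rfl⟩ := exists_joinExp u
    obtain ⟨d, b, rfl⟩ := exists_joinExp v
    rw [Finset.HasAntidiagonal.mem_antidiagonal, ← joinExp_add, joinExp_inj] at h
    exact ⟨⟨⟨a, b⟩, c, d⟩, by simp [h.1, h.2], rfl⟩
  · intro _ _
    rfl

/-- Embedding of the indices of `(X, Y)` into those of `(X', Y)`. -/
def padEmb {m m' : ℕ} (n : ℕ) (e : Fin m ↪ Fin m') : Fin (m + n) ↪ Fin (m' + n) :=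
  finSumFinEquiv.symm.toEmbedding.trans
    ((e.sumMap (Function.Embedding.refl _)).trans finSumFinEquiv.toEmbedding)

lemma embDomain_padEmb {m m' n : ℕ} (e : Fin m ↪ Fin m') (μ : Fin m →₀ ℕ) (ν : Fin n →₀ ℕ) :
    Finsupp.embDomain (padEmb n e) (joinExp μ ν) = joinExp (Finsupp.embDomain e μ) ν := by
  ext i
  refine Fin.addCases (fun i => ?_) (fun i => ?_) i
  · by_cases h : i ∈ Set.range e
    · obtain ⟨j, rfl⟩ := h
      have : Fin.castAdd n (e j) = padEmb n e (Fin.castAdd n j) := by simp [padEmb]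
      rw [this, Finsupp.embDomain_apply_self, ← this]
      simp [joinExp]
    · rw [Finsupp.embDomain_of_notMem_range]
      · simp [joinExp, Finsupp.embDomain_of_notMem_range _ _ _ h]
      · rintro ⟨k, hk⟩
        revert hk
        refine Fin.addCases (fun k => ?_) (fun k => ?_) k
        · intro hk
          refine h ⟨k, ?_⟩
          simpa [padEmb] using hk
        · intro hk
          have := congrArg Fin.val hk
          simp [padEmb] at this
          omega
  · have : Fin.natAdd m' i = padEmb n e (Fin.natAdd m i) := by simp [padEmb]
    rw [this, Finsupp.embDomain_apply_self, ← this]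
    simp [joinExp]

lemma slice_renameVars {𝔬 : Ideal A} {m m' n : ℕ} (e : Fin m ↪ Fin m')
    (f : restricted 𝔬 (m + n)) (ν : Fin n →₀ ℕ) :
    slice (renameVars 𝔬 (padEmb n e) f) ν = renameVars 𝔬 e (slice f ν) := by
  apply Subtype.ext
  ext μ
  change coeff (joinExp μ ν) (rename (padEmb n e) (f : MvPowerSeries _ A)) =
    coeff μ (rename e (sliceSeries (f : MvPowerSeries _ A) ν))
  by_cases h : μ ∈ Set.range (Finsupp.mapDomain e)
  · obtain ⟨κ, rfl⟩ := h
    rw [← Finsupp.embDomain_eq_mapDomain, ← embDomain_padEmb, coeff_embDomain_rename,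
      coeff_embDomain_rename, coeff_sliceSeries]
  · rw [coeff_rename_eq_zero _ _ h, coeff_rename_eq_zero]
    rintro ⟨κ, hκ⟩
    obtain ⟨a, b, rfl⟩ := exists_joinExp κ
    rw [← Finsupp.embDomain_eq_mapDomain, embDomain_padEmb, joinExp_inj] at hκ
    exact h ⟨a, by rw [← Finsupp.embDomain_eq_mapDomain]; exact hκ.1⟩

end RestrictedSeries

/-- An `A`-analytic structure on a ring `R`: ring morphisms `ι_n` from `A⟨Y₁, …, Yₙ⟩` to the ring
of `R`-valued functions on `Rⁿ`, one for each `n`, such that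
* `ι_n(Y_k)` is the `k`-th coordinate function;
* `ι_n(f)(y₁, …, yₙ) = ι_{n+1}(f)(y₁, …, yₙ₊₁)` for `f ∈ A⟨Y₁, …, Yₙ⟩ ⊆ A⟨Y₁, …, Yₙ₊₁⟩`;
* `ι_n(f)(yₙ₊₁, …, y₂ₙ) = ι_{2n}(f(Yₙ₊₁, …, Y₂ₙ))(y₁, …, y₂ₙ)` for `f ∈ A⟨Y₁, …, Yₙ⟩`. -/
structure AnalyticStructure {A : Type*} [CommRing A] (𝔬 : Ideal A) (R : Type*) [CommRing R] where
  iota : ∀ n : ℕ, restricted 𝔬 n →+* ((Fin n → R) → R)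
  iota_indet : ∀ (n : ℕ) (k : Fin n) (y : Fin n → R), iota n (indet 𝔬 k) y = y k
  iota_castSucc : ∀ (n : ℕ) (f : restricted 𝔬 n) (y : Fin (n + 1) → R),
    iota n f (fun i => y i.castSucc) =
      iota (n + 1) (renameVars 𝔬 (Fin.castSuccEmb (n := n)) f) y
  iota_shift : ∀ (n : ℕ) (f : restricted 𝔬 n) (y : Fin (n + n) → R),
    iota n f (fun i => y (Fin.natAdd n i)) =
      iota (n + n) (renameVars 𝔬 (Fin.natAddEmb n (m := n)) f) y

namespace AnalyticStructure

variable {A : Type*} [CommRing A] {𝔬 : Ideal A} {R : Type*} [CommRing R]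

/-- The structural morphism `ι₀ : A → R`. -/
noncomputable def structMap (S : AnalyticStructure 𝔬 R) : A →+* R :=
  (Pi.evalRingHom (fun _ : Fin 0 → R => R) Fin.elim0).comp ((S.iota 0).comp (constants 𝔬 0))

/-- `R` is viable: the ideal `𝔬 R` is the maximal ideal of `R`, and is nonzero. -/
def IsViable [IsLocalRing R] (S : AnalyticStructure 𝔬 R) : Prop :=
  𝔬.map S.structMap = IsLocalRing.maximalIdeal R ∧ IsLocalRing.maximalIdeal R ≠ ⊥

/-- The analytic structure of the `R`-algebra `R'` extends that of `R`. -/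
def Extends {R' : Type*} [CommRing R'] [Algebra R R'] (S' : AnalyticStructure 𝔬 R')
    (S : AnalyticStructure 𝔬 R) : Prop :=
  ∀ (n : ℕ) (f : restricted 𝔬 n) (y : Fin n → R),
    S'.iota n f (fun i => algebraMap R R' (y i)) = algebraMap R R' (S.iota n f y)

/-- `f(x, Y) = ∑_ν f_ν(x) Y ^ ν` in `R[[Y]]`, for `f = ∑_ν f_ν(X) Y ^ ν` in `A⟨X, Y⟩` and
`x ∈ R ^ m`. -/
noncomputable def specialize (S : AnalyticStructure 𝔬 R) {m n : ℕ} (f : restricted 𝔬 (m + n))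
    (x : Fin m → R) : MvPowerSeries (Fin n) R :=
  fun ν => S.iota m (slice f ν) x

lemma coeff_specialize (S : AnalyticStructure 𝔬 R) {m n : ℕ} (f : restricted 𝔬 (m + n))
    (x : Fin m → R) (ν : Fin n →₀ ℕ) :
    coeff ν (S.specialize f x) = S.iota m (slice f ν) x := rfl

lemma specialize_add (S : AnalyticStructure 𝔬 R) {m n : ℕ} (f g : restricted 𝔬 (m + n))
    (x : Fin m → R) : S.specialize (f + g) x = S.specialize f x + S.specialize g x := by
  ext ν
  simp only [map_add, coeff_specialize, slice_add, Pi.add_apply]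

lemma specialize_mul (S : AnalyticStructure 𝔬 R) {m n : ℕ} (f g : restricted 𝔬 (m + n))
    (x : Fin m → R) : S.specialize (f * g) x = S.specialize f x * S.specialize g x := by
  classical
  ext ν
  simp only [coeff_mul, coeff_specialize, slice_mul, map_sum, map_mul, Finset.sum_apply,
    Pi.mul_apply]

lemma specialize_const (S : AnalyticStructure 𝔬 R) {n : ℕ} (a : R) :
    S.specialize (indet 𝔬 (Fin.castAdd n (0 : Fin 1))) (fun _ => a) = C a := by
  classical
  ext ν
  have key : joinExp (Finsupp.single (0 : Fin 1) 1) (0 : Fin n →₀ ℕ) =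
      Finsupp.single (Fin.castAdd n (0 : Fin 1)) 1 := by
    ext i
    refine Fin.addCases (fun i => ?_) (fun i => ?_) i
    · have : i = 0 := Subsingleton.elim _ _
      subst this
      simp [joinExp]
    · have : Fin.castAdd n (0 : Fin 1) ≠ Fin.natAdd 1 i := by
        intro h
        have := congrArg Fin.val h
        simp at this
        omega
      simp [joinExp, Finsupp.single_eq_of_ne' this]
  rw [coeff_specialize, coeff_C]
  split_ifs with h
  · subst h
    have : slice (indet 𝔬 (Fin.castAdd n (0 : Fin 1))) 0 = indet 𝔬 (0 : Fin 1) := by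
      apply Subtype.ext
      ext μ
      change coeff (joinExp μ 0) (X (Fin.castAdd n (0 : Fin 1)) : MvPowerSeries _ A) =
        coeff μ (X (0 : Fin 1))
      rw [coeff_X, coeff_X, ← key]
      simp only [joinExp_inj, and_true]
    rw [this, S.iota_indet]
  · have : slice (indet 𝔬 (Fin.castAdd n (0 : Fin 1))) ν = 0 := by
      apply Subtype.ext
      ext μ
      change coeff (joinExp μ ν) (X (Fin.castAdd n (0 : Fin 1)) : MvPowerSeries _ A) = 0
      rw [coeff_X, ← key, if_neg]
      rw [joinExp_inj]
      exact fun h' => h h'.2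
    rw [this, map_zero, Pi.zero_apply]

lemma specialize_rename (S : AnalyticStructure 𝔬 R) {m m' n : ℕ} (e : Fin m ↪ Fin m')
    (x : Fin m' → R)
    (he : ∀ h : restricted 𝔬 m, S.iota m' (renameVars 𝔬 e h) x = S.iota m h fun i => x (e i))
    (f : restricted 𝔬 (m + n)) :
    S.specialize (renameVars 𝔬 (padEmb n e) f) x = S.specialize f fun i => x (e i) := by
  ext ν
  rw [coeff_specialize, coeff_specialize, slice_renameVars, he]

lemma exists_pad (S : AnalyticStructure 𝔬 R) {m n : ℕ} (f : restricted 𝔬 (m + n))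
    (x : Fin m → R) (k : ℕ) :
    ∃ (f' : restricted 𝔬 (m + k + n)) (x' : Fin (m + k) → R),
      S.specialize f' x' = S.specialize f x ∧ ∀ i, x' (Fin.castAdd k i) = x i := by
  induction k with
  | zero => exact ⟨f, x, rfl, fun _ => rfl⟩
  | succ k ih =>
    obtain ⟨f', x', h, hx⟩ := ih
    refine ⟨renameVars 𝔬 (padEmb n (Fin.castSuccEmb (n := m + k))) f',
      Fin.snoc (α := fun _ => R) x' 0, ?_, fun i => ?_⟩
    · rw [← h]
      have := S.specialize_rename (Fin.castSuccEmb (n := m + k))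
        (Fin.snoc (α := fun _ => R) x' 0) (fun g => (S.iota_castSucc _ g _).symm) f'
      rw [this]
      congr 1
      ext i
      simp
    · rw [← hx i]
      exact Fin.snoc_castSucc (α := fun _ => R) 0 x' (Fin.castAdd k i)

lemma iota_castAdd (S : AnalyticStructure 𝔬 R) (m k : ℕ) (f : restricted 𝔬 m)
    (x : Fin (m + k) → R) :
    S.iota (m + k) (renameVars 𝔬 (Fin.castAddEmb k (n := m)) f) x =
      S.iota m f fun i => x (Fin.castAdd k i) := by
  induction k with
  | zero =>
    have h : renameVars 𝔬 (Fin.castAddEmb 0 (n := m)) f = f :=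
      Subtype.ext (rename_id_apply (f : MvPowerSeries (Fin m) A))
    exact congrArg (fun g => S.iota m g x) h
  | succ k ih =>
    have h1 := S.iota_castSucc (m + k) (renameVars 𝔬 (Fin.castAddEmb k (n := m)) f) x
    rw [ih] at h1
    have h2 : renameVars 𝔬 (Fin.castAddEmb (k + 1) (n := m)) f =
        renameVars 𝔬 (Fin.castSuccEmb (n := m + k)) (renameVars 𝔬 (Fin.castAddEmb k (n := m)) f) :=
      Subtype.ext (rename_rename (Fin.castAddEmb k (n := m)) (Fin.castSuccEmb (n := m + k))
        (f : MvPowerSeries (Fin m) A)).symm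
    exact (congrArg (fun g => S.iota (m + k + 1) g x) h2).trans h1.symm

/-- Two series `f(x, Y)` and `g(x', Y)` can be written with the same parameters. -/
lemma exists_common (S : AnalyticStructure 𝔬 R) {m m' n : ℕ} (f : restricted 𝔬 (m + n))
    (x : Fin m → R) (g : restricted 𝔬 (m' + n)) (x' : Fin m' → R) :
    ∃ (k : ℕ) (z : Fin k → R) (f' g' : restricted 𝔬 (k + n)),
      S.specialize f' z = S.specialize f x ∧ S.specialize g' z = S.specialize g x' := by
  obtain ⟨N, f₁, g₁, u, v, hf, hg⟩ : ∃ (N : ℕ) (f₁ g₁ : restricted 𝔬 (N + n))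
      (u v : Fin N → R), S.specialize f₁ u = S.specialize f x ∧
        S.specialize g₁ v = S.specialize g x' := by
    obtain ⟨f₁, u, hf, -⟩ := S.exists_pad f x m'
    obtain ⟨g₁, v, hg⟩ : ∃ (g₁ : restricted 𝔬 (m + m' + n)) (v : Fin (m + m') → R),
        S.specialize g₁ v = S.specialize g x' := by
      rw [Nat.add_comm m m']
      obtain ⟨g₁, v, hg, -⟩ := S.exists_pad g x' m
      exact ⟨g₁, v, hg⟩
    exact ⟨m + m', f₁, g₁, u, v, hf, hg⟩
  refine ⟨N + N, Fin.append u v,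
    renameVars 𝔬 (padEmb n (Fin.castAddEmb N (n := N))) f₁,
    renameVars 𝔬 (padEmb n (Fin.natAddEmb N (m := N))) g₁, ?_, ?_⟩
  · rw [← hf, S.specialize_rename _ _ (fun h => S.iota_castAdd _ _ h _)]
    congr 1
    ext i
    simp
  · rw [← hg, S.specialize_rename _ _ (fun h => (S.iota_shift _ h _).symm)]
    congr 1
    ext i
    exact Fin.append_right u v i

/-- The ring `R⟨Y⟩ = R⟨Y₁, …, Yₙ⟩`, consisting of the series `f(x, Y) ∈ R[[Y]]` with `m ∈ ℕ`,
`f ∈ A⟨X₁, …, Xₘ, Y₁, …, Yₙ⟩` and `x ∈ R ^ m`. -/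
def series (S : AnalyticStructure 𝔬 R) (n : ℕ) : Subring (MvPowerSeries (Fin n) R) where
  carrier := {g | ∃ (m : ℕ) (f : restricted 𝔬 (m + n)) (x : Fin m → R), S.specialize f x = g}
  zero_mem' := ⟨1, _, fun _ => 0, (S.specialize_const 0).trans (map_zero _)⟩
  one_mem' := ⟨1, _, fun _ => 1, (S.specialize_const 1).trans (map_one _)⟩
  add_mem' := by
    rintro _ _ ⟨m, f, x, rfl⟩ ⟨m', g, x', rfl⟩
    obtain ⟨k, z, f', g', hf, hg⟩ := S.exists_common f x g x'
    exact ⟨k, f' + g', z, by rw [specialize_add, hf, hg]⟩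
  mul_mem' := by
    rintro _ _ ⟨m, f, x, rfl⟩ ⟨m', g, x', rfl⟩
    obtain ⟨k, z, f', g', hf, hg⟩ := S.exists_common f x g x'
    exact ⟨k, f' * g', z, by rw [specialize_mul, hf, hg]⟩
  neg_mem' := by
    rintro _ ⟨m, f, x, rfl⟩
    refine ⟨m, -f, x, ?_⟩
    have h : S.specialize (-f + f) x = 0 := by
      rw [neg_add_cancel]
      ext ν
      have : slice (0 : restricted 𝔬 (m + n)) ν = 0 := rfl
      rw [coeff_specialize, this, map_zero, Pi.zero_apply, map_zero]
    rw [specialize_add] at h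
    exact eq_neg_of_add_eq_zero_left h

lemma C_mem_series (S : AnalyticStructure 𝔬 R) (n : ℕ) (a : R) :
    (C a : MvPowerSeries (Fin n) R) ∈ S.series n :=
  ⟨1, _, fun _ => a, S.specialize_const a⟩

section Fractions

variable [IsDomain R]

/-- The `K`-algebra `K⟨Y⟩ = {c⁻¹ g : c ∈ R ∖ {0}, g ∈ R⟨Y⟩} ⊆ K[[Y]]`, where `K` is the fraction
field of `R`. -/
def fracSeries (S : AnalyticStructure 𝔬 R) (K : Type*) [Field K] [Algebra R K]
    [IsFractionRing R K] (n : ℕ) : Subalgebra K (MvPowerSeries (Fin n) K) where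
  carrier := {f | ∃ c : R, c ≠ 0 ∧ ∃ g ∈ S.series n,
    f = (algebraMap R K c)⁻¹ • MvPowerSeries.map (algebraMap R K) g}
  algebraMap_mem' k := by
    obtain ⟨a, b, hb, rfl⟩ := IsFractionRing.div_surjective (A := R) k
    refine ⟨b, nonZeroDivisors.ne_zero hb, C a, S.C_mem_series n a, ?_⟩
    rw [map_C, MvPowerSeries.algebraMap_apply, Algebra.algebraMap_self_apply, smul_eq_C_mul,
      ← map_mul, div_eq_inv_mul]
  add_mem' := by
    rintro _ _ ⟨c, hc, g, hg, rfl⟩ ⟨d, hd, h, hh, rfl⟩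
    have hc' : algebraMap R K c ≠ 0 := by simpa using hc
    have hd' : algebraMap R K d ≠ 0 := by simpa using hd
    refine ⟨c * d, mul_ne_zero hc hd, C d * g + C c * h,
      add_mem (mul_mem (S.C_mem_series n d) hg) (mul_mem (S.C_mem_series n c) hh), ?_⟩
    simp only [map_add, map_mul, map_C]
    rw [← smul_eq_C_mul, ← smul_eq_C_mul, smul_add,
      smul_smul, smul_smul]
    congr 2 <;> field_simp
  mul_mem' := by
    rintro _ _ ⟨c, hc, g, hg, rfl⟩ ⟨d, hd, h, hh, rfl⟩
    refine ⟨c * d, mul_ne_zero hc hd, g * h, mul_mem hg hh, ?_⟩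
    rw [map_mul, map_mul, smul_mul_smul_comm, mul_inv]

/-- `S.HasValueAt g y z` says that `z` is the value `g(y)`, in the fraction field `K` of `R`, of
`g ∈ K⟨Y⟩` at `y ∈ R ^ n`: for `g = c⁻¹ f(x, Y)` with `c ∈ R ∖ {0}`, `f ∈ A⟨X, Y⟩` and `x ∈ R ^ m`
this value is `c⁻¹ f(x, y)`. -/
def HasValueAt (S : AnalyticStructure 𝔬 R) {K : Type*} [Field K] [Algebra R K]
    [IsFractionRing R K] {n : ℕ} (g : MvPowerSeries (Fin n) K) (y : Fin n → R) (z : K) : Prop :=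
  ∃ c : R, c ≠ 0 ∧ ∃ (m : ℕ) (f : restricted 𝔬 (m + n)) (x : Fin m → R),
    g = (algebraMap R K c)⁻¹ • MvPowerSeries.map (algebraMap R K) (S.specialize f x) ∧
    z = (algebraMap R K c)⁻¹ * algebraMap R K (S.iota (m + n) f (Fin.append x y))

end Fractions

end AnalyticStructure

end AnalyticRing

/-!
Write `k` for the residue field of `R`. Since `𝔬 R` is the maximal ideal, reduction maps `R⟨Y⟩`
onto the polynomial ring `k[Y]`, with kernel `𝔬 R⟨Y⟩`. For a proper ideal `I` of `R⟨Y⟩`, Noether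
normalization of the finitely generated `k`-algebra `k[Y] / Ī` gives `s` polynomials over which it
is finite. As `R⟨Y⟩ / I` again carries an `A`-analytic structure, arbitrary lifts of them define a
morphism `R⟨Z₁, …, Z_s⟩ → R⟨Y⟩ / I`, which is finite modulo `𝔬`. By Nakayama's lemma it is finite:
`R⟨Y⟩` need be neither noetherian nor complete, but finitely many relations involve finitely many
coefficients from `R`, and so lift to some `A⟨X, Y⟩`, which is both. The morphism is injective if
`R⟨Y⟩ / I` is torsion free, because over the valuation ring `R` every nonzero series is a constant
times one with nonzero reduction. Inverting the nonzero elements of `R` gives the normalization of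
`K⟨Y⟩ / I`; if `I ≠ 0`, then `s < n`, and `K⟨Y⟩` is noetherian by induction on `n`.

If `I` is maximal, then `s = 0`, so the indeterminates are integral over `R` modulo `I`, and
their images under an embedding of `K⟨Y⟩ / I` into `Kᵃ` lie in `Rᵃ`. The embedding is then
evaluation at these images, since a series is congruent to a polynomial modulo `𝔬`, and by
Nakayama's lemma the integral indeterminates generate the quotient of `R⟨Y⟩` as an `R`-algebra.
-/

namespace AnalyticRing

open MvPowerSeries

section DenseSubring

lemma exists_ringHom_extending {P B Q : Type*} [CommRing P] [CommRing B] [CommRing Q]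
    {𝔮 : Ideal Q} [IsAdicComplete 𝔮 Q] {𝔟 : ℕ → Ideal B} (h𝔟 : Antitone 𝔟) {ι : P →+* B}
    {g : P →+* Q} (dense : ∀ e b, ∃ p, b - ι p ∈ 𝔟 e)
    (continuous : ∀ e p, ι p ∈ 𝔟 e → g p ∈ 𝔮 ^ e) :
    ∃ φ : B →+* Q, ∀ p, φ (ι p) = g p := by
  have surjective : ∀ e, Function.Surjective ((Ideal.Quotient.mk (𝔟 e)).comp ι) := by
    intro e x
    obtain ⟨b, rfl⟩ := Ideal.Quotient.mk_surjective x
    obtain ⟨p, hp⟩ := dense e b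
    exact ⟨p, (Ideal.Quotient.eq.2 hp).symm⟩
  let f : ∀ e, B →+* Q ⧸ 𝔮 ^ e := fun e =>
    ((((Ideal.Quotient.mk (𝔟 e)).comp ι).liftOfSurjective (surjective e)
      ⟨(Ideal.Quotient.mk (𝔮 ^ e)).comp g, fun p hp => Ideal.Quotient.eq_zero_iff_mem.2
        (continuous e p (Ideal.Quotient.eq_zero_iff_mem.1 hp))⟩)).comp (Ideal.Quotient.mk (𝔟 e))
  have f_apply : ∀ {e b p}, b - ι p ∈ 𝔟 e → f e b = Ideal.Quotient.mk (𝔮 ^ e) (g p) := by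
    intro e b p h
    rw [RingHom.comp_apply, Ideal.Quotient.eq.2 h]
    exact RingHom.liftOfRightInverse_comp_apply ..
  have compatible : ∀ {i j} (hij : i ≤ j), (Ideal.Quotient.factorPow 𝔮 hij).comp (f j) = f i := by
    intro i j hij
    ext b
    obtain ⟨p, hp⟩ := dense j b
    rw [RingHom.comp_apply, f_apply hp, f_apply (h𝔟 hij hp)]
    rfl
  refine ⟨IsAdicComplete.liftRingHom 𝔮 f compatible, fun p => sub_eq_zero.1 ?_⟩
  refine IsHausdorff.haus (inferInstance : IsHausdorff 𝔮 Q) _ fun e => ?_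
  rw [SModEq.zero, smul_eq_mul, Ideal.mul_top, ← Ideal.Quotient.eq,
    IsAdicComplete.mk_liftRingHom, f_apply (sub_self (ι p) ▸ zero_mem _)]

lemma exists_ringHom_adicCompletion {P Q : Type*} [CommRing P] [CommRing Q] {J : Ideal P}
    {𝔮 : Ideal Q} [IsAdicComplete 𝔮 Q] {g : P →+* Q} (hg : J.map g ≤ 𝔮) :
    ∃ φ : AdicCompletion J P →+* Q, ∀ p, φ (algebraMap P _ p) = g p := by
  refine exists_ringHom_extending (𝔮 := 𝔮)
    (𝔟 := fun e => RingHom.ker (AdicCompletion.evalₐ J e)) ?_ ?_ ?_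
  · intro i j hij x hx
    obtain ⟨x, rfl⟩ := AdicCompletion.mk_surjective J P x
    rw [RingHom.mem_ker, AdicCompletion.evalₐ_mk] at hx ⊢
    refine (AdicCompletion.Ideal.mk_eq_mk J hij x).symm.trans (Ideal.Quotient.eq_zero_iff_mem.2 ?_)
    exact Ideal.pow_le_pow_right hij (Ideal.Quotient.eq_zero_iff_mem.1 hx)
  · intro e x
    obtain ⟨p, hp⟩ := Ideal.Quotient.mk_surjective (AdicCompletion.evalₐ J e x)
    exact ⟨p, by simp [RingHom.mem_ker, hp]⟩
  · intro e p hp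
    rw [RingHom.mem_ker, AlgHom.commutes, Ideal.Quotient.algebraMap_eq,
      Ideal.Quotient.eq_zero_iff_mem] at hp
    exact Ideal.pow_right_mono hg e (Ideal.map_pow g J e ▸ Ideal.mem_map_of_mem g hp)

lemma isNoetherianRing_of_isAdicComplete {P B : Type*} [CommRing P] [CommRing B]
    [IsNoetherianRing P] {𝔟 : Ideal B} [IsAdicComplete 𝔟 B] (h𝔟 : 𝔟.FG) (g : P →+* B)
    (hg : Function.Surjective ((Ideal.Quotient.mk 𝔟).comp g)) : IsNoetherianRing B := by
  obtain ⟨r, a, ha⟩ := Submodule.fg_iff_exists_fin_generating_family.1 h𝔟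
  let J := MvPolynomial.idealOfVars (Fin r) P
  let ext := AdicCompletion J (MvPolynomial (Fin r) P)
  have map_J : J.map (MvPolynomial.eval₂Hom g a) = 𝔟 := by
    rw [← ha]
    simp only [J, MvPolynomial.idealOfVars, Ideal.map_span, ← Set.range_comp]
    congr 2
    ext x
    simp
  obtain ⟨φ, hφ⟩ := exists_ringHom_adicCompletion map_J.le
  have map_φ : (J.map (algebraMap _ ext)).map φ = 𝔟 := by
    rw [Ideal.map_map, show φ.comp (algebraMap _ _) = MvPolynomial.eval₂Hom g a from
      RingHom.ext hφ, map_J]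
  have : IsAdicComplete (J.map (algebraMap _ ext)) ext := by
    rw [IsAdicComplete.map_algebraMap_iff]
    exact AdicCompletion.isAdicComplete (MvPolynomial.idealOfVars_fg _ _)
  have : IsHausdorff ((J.map (algebraMap _ ext)).map φ) B := map_φ ▸ inferInstance
  have : IsNoetherianRing ext :=
    isNoetherianRing_of_ringEquiv _ (toAdicCompletionAlgEquiv (Fin r) P).toRingEquiv
  refine isNoetherianRing_of_surjective _ _ φ
    (surjective_of_mk_map_comp_surjective (I := J.map (algebraMap _ ext)) φ fun x => ?_)
  obtain ⟨b, rfl⟩ := Ideal.Quotient.mk_surjective x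
  obtain ⟨p, hp⟩ := hg (Ideal.Quotient.mk _ b)
  refine ⟨algebraMap (MvPolynomial (Fin r) P) _ (MvPolynomial.C p), ?_⟩
  rw [RingHom.comp_apply, hφ, Ideal.Quotient.eq, map_φ, ← Ideal.Quotient.eq]
  simpa using hp

end DenseSubring

section SubringOfPowerSeries

variable {σ R : Type*} [CommRing R] {P : Subring (MvPowerSeries σ R)} [Algebra R P]
  (coe_algebraMap : ∀ a, (algebraMap R P a : MvPowerSeries σ R) = C a)

include coe_algebraMap

lemma coeff_mem_of_mem_map_algebraMap {J : Ideal R} {f : P} (hf : f ∈ J.map (algebraMap R P))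
    (ν : σ →₀ ℕ) : coeff ν f.1 ∈ J := by
  have map_le : J.map (algebraMap R P) ≤
      RingHom.ker ((MvPowerSeries.map (Ideal.Quotient.mk J)).comp P.subtype) :=
    Ideal.map_le_iff_le_comap.2 fun a ha => by
      simp [RingHom.mem_ker, coe_algebraMap, Ideal.Quotient.eq_zero_iff_mem.2 ha]
  simpa [Ideal.Quotient.eq_zero_iff_mem] using congrArg (coeff ν) (map_le hf)

lemma coe_aeval_of_coe_eq_X {y : σ → P} (hy : ∀ i, (y i : MvPowerSeries σ R) = X i)
    (p : MvPolynomial σ R) : (MvPolynomial.aeval y p : MvPowerSeries σ R) = p := by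
  have : P.subtype.comp (MvPolynomial.aeval y : _ →ₐ[R] P).toRingHom =
      MvPolynomial.coeToMvPowerSeries.ringHom := by
    apply MvPolynomial.ringHom_ext
    · simp [coe_algebraMap]
    · simp [hy]
  exact congrArg (fun φ => φ p) this

end SubringOfPowerSeries

section RestrictedAlgebra

variable {A : Type*} [CommRing A] {𝔬 : Ideal A} {n : ℕ}

noncomputable instance : Algebra A (restricted 𝔬 n) := (constants 𝔬 n).toAlgebra

lemma restricted.coe_algebraMap (a : A) :
    (algebraMap A (restricted 𝔬 n) a : MvPowerSeries (Fin n) A) = C a := rfl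

lemma coe_aeval_indet (p : MvPolynomial (Fin n) A) :
    (MvPolynomial.aeval (indet 𝔬 (n := n)) p : MvPowerSeries (Fin n) A) = p :=
  coe_aeval_of_coe_eq_X restricted.coe_algebraMap (fun _ => rfl) p

/- The coefficient at `ν` is written as a combination of the `a i` whose coefficients lie in `𝔬 ^ k`
with `k ≤ |ν|` as large as possible; these coefficients then tend to `0` as `|ν| → ∞`. -/
lemma exists_eq_sum_algebraMap_mul {ι : Type*} [Fintype ι] {e : ℕ} {a : ι → A}
    (ha : Ideal.span (Set.range a) = 𝔬 ^ e) {f : restricted 𝔬 n}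
    (hf : ∀ ν, coeff ν f.1 ∈ 𝔬 ^ e) :
    ∃ g : ι → restricted 𝔬 n, f = ∑ i, algebraMap A (restricted 𝔬 n) (a i) * g i := by
  classical
  let k : (Fin n →₀ ℕ) → ℕ := fun ν =>
    Nat.findGreatest (fun j => coeff ν f.1 ∈ 𝔬 ^ (j + e)) ν.degree
  have coeff_mem : ∀ ν, coeff ν f.1 ∈ 𝔬 ^ k ν • Ideal.span (Set.range a) := fun ν => by
    rw [ha, smul_eq_mul, ← pow_add]
    exact Nat.findGreatest_spec (P := fun j => coeff ν f.1 ∈ 𝔬 ^ (j + e)) (Nat.zero_le _)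
      (by simpa using hf ν)
  choose c hc sum_c using fun ν =>
    (Submodule.mem_ideal_smul_span_iff_exists_sum _ _ _).1 (coeff_mem ν)
  have c_restricted : ∀ i, (fun ν => c ν i : MvPowerSeries (Fin n) A) ∈ restricted 𝔬 n := by
    intro i d
    refine ((Finsupp.finite_of_degree_le (σ := Fin n) d).union (f.2 (d + e))).subset fun ν hν => ?_
    by_contra h
    simp only [Set.mem_union, Set.mem_ofPred_eq, not_or, not_not, not_le] at h
    exact hν (Ideal.pow_le_pow_right (Nat.le_findGreatest h.1.le h.2) (hc ν i))
  refine ⟨fun i => ⟨_, c_restricted i⟩, Subtype.ext (MvPowerSeries.ext fun ν => ?_)⟩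
  rw [AddSubmonoidClass.coe_finsetSum, map_sum, ← sum_c ν, Finsupp.sum_fintype _ _ (by simp)]
  refine Finset.sum_congr rfl fun i _ => ?_
  rw [Subring.coe_mul, restricted.coe_algebraMap, coeff_C_mul, mul_comm]
  rfl

variable [IsNoetherianRing A]

lemma mem_map_pow_iff {e : ℕ} {f : restricted 𝔬 n} :
    f ∈ (𝔬 ^ e).map (algebraMap A (restricted 𝔬 n)) ↔ ∀ ν, coeff ν f.1 ∈ 𝔬 ^ e := by
  refine ⟨coeff_mem_of_mem_map_algebraMap restricted.coe_algebraMap, fun hf => ?_⟩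
  obtain ⟨r, a, ha⟩ := Submodule.fg_iff_exists_fin_generating_family.1
    (IsNoetherian.noetherian (𝔬 ^ e))
  obtain ⟨g, rfl⟩ := exists_eq_sum_algebraMap_mul ha hf
  exact Ideal.sum_mem _ fun i _ => Ideal.mul_mem_right _ _
    (Ideal.mem_map_of_mem _ (ha ▸ Submodule.subset_span ⟨i, rfl⟩))

lemma mem_pow_smul_top_iff {e : ℕ} {f : restricted 𝔬 n} :
    f ∈ (𝔬 ^ e • ⊤ : Submodule A (restricted 𝔬 n)) ↔ ∀ ν, coeff ν f.1 ∈ 𝔬 ^ e := by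
  rw [Ideal.smul_top_eq_map, Submodule.restrictScalars_mem, mem_map_pow_iff]

instance [IsHausdorff 𝔬 A] : IsHausdorff 𝔬 (restricted 𝔬 n) where
  haus' f hf := by
    refine Subtype.ext (MvPowerSeries.ext fun ν => ?_)
    refine IsHausdorff.haus (inferInstance : IsHausdorff 𝔬 A) _ fun e => ?_
    have := mem_pow_smul_top_iff.1 (SModEq.zero.1 (hf e)) ν
    rwa [SModEq.zero, smul_eq_mul, Ideal.mul_top]

instance [IsPrecomplete 𝔬 A] : IsPrecomplete 𝔬 (restricted 𝔬 n) where
  prec' F hF := by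
    have exists_limit : ∀ ν, ∃ l : A, ∀ e, coeff ν (F e).1 - l ∈ 𝔬 ^ e := fun ν => by
      simpa [SModEq.sub_mem] using IsPrecomplete.prec (inferInstance : IsPrecomplete 𝔬 A)
        (f := fun e => coeff ν (F e).1) fun hij => by
          simpa [SModEq.sub_mem] using mem_pow_smul_top_iff.1 (SModEq.sub_mem.1 (hF hij)) ν
    choose l hl using exists_limit
    refine ⟨⟨l, fun e => ((F e).2 e).subset fun ν hν h => hν ?_⟩, fun e => ?_⟩
    · exact (Submodule.sub_mem_iff_right _ h).1 (hl ν e)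
    · exact SModEq.sub_mem.2 (mem_pow_smul_top_iff.2 fun ν => hl ν e)

instance [IsAdicComplete 𝔬 A] : IsAdicComplete 𝔬 (restricted 𝔬 n) where

instance [IsAdicComplete 𝔬 A] :
    IsAdicComplete (𝔬.map (algebraMap A (restricted 𝔬 n))) (restricted 𝔬 n) :=
  (IsAdicComplete.map_algebraMap_iff _ _).2 inferInstance

lemma exists_sub_aeval_indet_mem (f : restricted 𝔬 n) (e : ℕ) : ∃ p : MvPolynomial (Fin n) A,
    f - MvPolynomial.aeval (indet 𝔬) p ∈ (𝔬 ^ e).map (algebraMap A (restricted 𝔬 n)) := by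
  classical
  refine ⟨∑ ν ∈ (f.2 e).toFinset, MvPolynomial.monomial ν (coeff ν f.1),
    mem_map_pow_iff.2 fun ν => ?_⟩
  rw [AddSubgroupClass.coe_sub, map_sub, coe_aeval_indet, MvPolynomial.coeff_coe]
  by_cases h : coeff ν f.1 ∈ 𝔬 ^ e <;>
    simp [MvPolynomial.coeff_sum, MvPolynomial.coeff_monomial, h]

lemma aeval_mem_map_pow {Q : Type*} [CommRing Q] [Algebra A Q] {e : ℕ} {p : MvPolynomial (Fin n) A}
    (hp : MvPolynomial.aeval (indet 𝔬) p ∈ (𝔬 ^ e).map (algebraMap A (restricted 𝔬 n)))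
    (c : Fin n → Q) : MvPolynomial.aeval c p ∈ (𝔬 ^ e).map (algebraMap A Q) := by
  have mem_map_C : p ∈ (𝔬 ^ e).map MvPolynomial.C := MvPolynomial.mem_map_C_iff.2 fun ν => by
    simpa [coe_aeval_indet] using mem_map_pow_iff.1 hp ν
  have := Ideal.mem_map_of_mem (MvPolynomial.aeval c : _ →ₐ[A] Q) mem_map_C
  rwa [← Ideal.map_coe, Ideal.map_map, ← MvPolynomial.algebraMap_eq,
    AlgHom.comp_algebraMap] at this

lemma restricted.algHom_ext {Q : Type*} [CommRing Q] [Algebra A Q]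
    [IsHausdorff (𝔬.map (algebraMap A Q)) Q] {φ ψ : restricted 𝔬 n →ₐ[A] Q}
    (h : ∀ i, φ (indet 𝔬 i) = ψ (indet 𝔬 i)) : φ = ψ := by
  have eq_on_polynomials : φ.comp (MvPolynomial.aeval (indet 𝔬)) =
      ψ.comp (MvPolynomial.aeval (indet 𝔬)) := MvPolynomial.algHom_ext (by simpa using h)
  ext f
  refine sub_eq_zero.1 (IsHausdorff.haus
    (inferInstance : IsHausdorff (𝔬.map (algebraMap A Q)) Q) _ fun e => ?_)
  rw [SModEq.zero, smul_eq_mul, Ideal.mul_top, ← Ideal.map_pow]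
  obtain ⟨p, hp⟩ := exists_sub_aeval_indet_mem f e
  have map_mem (χ : restricted 𝔬 n →ₐ[A] Q) :
      χ f - χ (MvPolynomial.aeval (indet 𝔬) p) ∈ (𝔬 ^ e).map (algebraMap A Q) := by
    have := Ideal.mem_map_of_mem χ hp
    rwa [← Ideal.map_coe, Ideal.map_map, AlgHom.comp_algebraMap, map_sub] at this
  have := sub_mem (map_mem φ) (map_mem ψ)
  rwa [show φ (MvPolynomial.aeval (indet 𝔬) p) = _ from congrArg (fun χ => χ p) eq_on_polynomials,
    AlgHom.comp_apply, sub_sub_sub_cancel_right] at this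

end RestrictedAlgebra

section Substitution

variable {A : Type*} [CommRing A] [IsNoetherianRing A] {𝔬 : Ideal A} {m n k : ℕ}

lemma exists_algHom_indet_eq {Q : Type*} [CommRing Q] [Algebra A Q]
    [IsAdicComplete (𝔬.map (algebraMap A Q)) Q] (c : Fin n → Q) :
    ∃ φ : restricted 𝔬 n →ₐ[A] Q, ∀ i, φ (indet 𝔬 i) = c i := by
  obtain ⟨φ, hφ⟩ := exists_ringHom_extending (𝔮 := 𝔬.map (algebraMap A Q))
    (𝔟 := fun e => (𝔬 ^ e).map (algebraMap A (restricted 𝔬 n)))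
    (ι := (MvPolynomial.aeval (indet 𝔬) : _ →ₐ[A] restricted 𝔬 n).toRingHom)
    (g := (MvPolynomial.aeval c : _ →ₐ[A] Q).toRingHom)
    (fun i j hij => Ideal.map_mono (Ideal.pow_le_pow_right hij))
    (fun e f => exists_sub_aeval_indet_mem f e)
    (fun e p hp => Ideal.map_pow (algebraMap A Q) 𝔬 e ▸ aeval_mem_map_pow hp c)
  exact ⟨⟨φ, fun a => by simpa using hφ (MvPolynomial.C a)⟩,
    fun i => by simpa using hφ (MvPolynomial.X i)⟩

variable [IsAdicComplete 𝔬 A]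

instance : IsNoetherianRing (restricted 𝔬 n) := by
  refine isNoetherianRing_of_isAdicComplete (𝔟 := 𝔬.map (algebraMap A (restricted 𝔬 n)))
    (Ideal.FG.map (IsNoetherian.noetherian 𝔬) _)
    (MvPolynomial.aeval (indet 𝔬 (n := n)) : _ →ₐ[A] _).toRingHom fun x => ?_
  obtain ⟨f, rfl⟩ := Ideal.Quotient.mk_surjective x
  obtain ⟨p, hp⟩ := exists_sub_aeval_indet_mem f 1
  exact ⟨p, (Ideal.Quotient.eq.2 (by rwa [pow_one] at hp)).symm⟩

instance (J : Ideal (restricted 𝔬 n)) :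
    IsHausdorff (𝔬.map (algebraMap A (restricted 𝔬 n ⧸ J))) (restricted 𝔬 n ⧸ J) :=
  IsHausdorff.map_algebraMap_iff.2 (IsHausdorff.map_algebraMap_iff.1
    (IsHausdorff.of_le_jacobson (𝔬.map (algebraMap A (restricted 𝔬 n))) (restricted 𝔬 n ⧸ J)
      (IsAdicComplete.le_jacobson_bot _)))

lemma algHom_sub_algHom_mem {φ ψ : restricted 𝔬 m →ₐ[A] restricted 𝔬 n}
    {J : Ideal (restricted 𝔬 n)} (h : ∀ i, φ (indet 𝔬 i) - ψ (indet 𝔬 i) ∈ J)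
    (f : restricted 𝔬 m) : φ f - ψ f ∈ J := by
  have : (Ideal.Quotient.mkₐ A J).comp φ = (Ideal.Quotient.mkₐ A J).comp ψ :=
    restricted.algHom_ext fun i => Ideal.Quotient.eq.2 (h i)
  exact Ideal.Quotient.eq.1 (congrArg (fun χ => χ f) this)

/-- Substitution `f ↦ f(c₁, …, cₙ)` of restricted series into restricted series: the unique
morphism of `A`-algebras taking `Y_i` to `c i`. -/
noncomputable def subst (c : Fin n → restricted 𝔬 m) : restricted 𝔬 n →ₐ[A] restricted 𝔬 m :=
  (exists_algHom_indet_eq c).choose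

@[simp]
lemma subst_indet (c : Fin n → restricted 𝔬 m) (i : Fin n) : subst c (indet 𝔬 i) = c i :=
  (exists_algHom_indet_eq c).choose_spec i

lemma algHom_subst (φ : restricted 𝔬 m →ₐ[A] restricted 𝔬 k) (c : Fin n → restricted 𝔬 m)
    (f : restricted 𝔬 n) : φ (subst c f) = subst (fun i => φ (c i)) f := by
  have : φ.comp (subst c) = subst (fun i => φ (c i)) := restricted.algHom_ext (by simp)
  exact congrArg (fun ψ => ψ f) this

lemma subst_self_indet (f : restricted 𝔬 n) : subst (indet 𝔬) f = f := by
  have : subst (indet 𝔬) = AlgHom.id A (restricted 𝔬 n) := restricted.algHom_ext (by simp)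
  exact congrArg (fun ψ => ψ f) this

lemma renameVars_eq_subst (e : Fin m ↪ Fin n) (f : restricted 𝔬 m) :
    renameVars 𝔬 e f = subst (fun i => indet 𝔬 (e i)) f := by
  let φ : restricted 𝔬 m →ₐ[A] restricted 𝔬 n :=
    ⟨renameVars 𝔬 e, fun a => Subtype.ext (rename_C e a)⟩
  have : φ = subst fun i => indet 𝔬 (e i) :=
    restricted.algHom_ext fun i => by
      rw [subst_indet]
      exact Subtype.ext (rename_X e i)
  exact congrArg (fun ψ => ψ f) this

end Substitution

section Slices

variable {A : Type*} [CommRing A] {𝔬 : Ideal A} {m n : ℕ}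

lemma joinExp_zero_right (μ : Fin m →₀ ℕ) :
    joinExp μ (0 : Fin n →₀ ℕ) = Finsupp.embDomain (Fin.castAddEmb n) μ := by
  ext i
  refine Fin.addCases (fun i => ?_) (fun i => ?_) i
  · have : Finsupp.embDomain (Fin.castAddEmb n) μ (Fin.castAddEmb n i) = μ i :=
      Finsupp.embDomain_apply_self _ _ _
    simpa [joinExp] using this.symm
  · have : Fin.natAdd m i ∉ Set.range (Fin.castAddEmb n) := by
      rintro ⟨k, hk⟩
      have := congrArg Fin.val hk
      simp only [Fin.castAddEmb_apply, Fin.val_castAdd, Fin.val_natAdd] at this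
      omega
    simp [joinExp, Finsupp.embDomain_of_notMem_range _ _ _ this]

lemma slice_renameVars_castAdd (g : restricted 𝔬 m) (ν : Fin n →₀ ℕ) [Decidable (ν = 0)] :
    slice (renameVars 𝔬 (Fin.castAddEmb n) g) ν = if ν = 0 then g else 0 := by
  refine Subtype.ext (MvPowerSeries.ext fun μ => ?_)
  change coeff (joinExp μ ν) (rename (Fin.castAddEmb n) g.1) = _
  split_ifs with h
  · rw [h, joinExp_zero_right, coeff_embDomain_rename]
  · refine coeff_rename_eq_zero _ _ ?_
    rintro ⟨κ, hκ⟩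
    rw [← Finsupp.embDomain_eq_mapDomain, ← joinExp_zero_right, joinExp_inj] at hκ
    exact h hκ.2.symm

lemma slice_aeval_monomial_joinExp (ν ν' : Fin n →₀ ℕ) [Decidable (ν' = ν)] :
    slice (MvPolynomial.aeval (indet 𝔬)
      (MvPolynomial.monomial (joinExp (0 : Fin m →₀ ℕ) ν) (1 : A))) ν' =
        if ν' = ν then 1 else 0 := by
  classical
  refine Subtype.ext (MvPowerSeries.ext fun μ => ?_)
  change coeff (joinExp μ ν') (MvPolynomial.aeval (indet 𝔬) _ : restricted 𝔬 (m + n)).1 = _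
  rw [coe_aeval_indet, MvPolynomial.coe_monomial, coeff_monomial]
  by_cases h : ν' = ν <;> simp [joinExp_inj, h, coeff_one]

lemma slice_renameVars_castAdd_mul_monomial (g : restricted 𝔬 m) (ν ν' : Fin n →₀ ℕ)
    [Decidable (ν' = ν)] :
    slice (renameVars 𝔬 (Fin.castAddEmb n) g * MvPolynomial.aeval (indet 𝔬)
      (MvPolynomial.monomial (joinExp 0 ν) (1 : A))) ν' = if ν' = ν then g else 0 := by
  classical
  rw [slice_mul, Finset.sum_eq_single (0, ν')]
  · simp [slice_renameVars_castAdd, slice_aeval_monomial_joinExp]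
  · rintro ⟨a, b⟩ hab hne
    have : a ≠ 0 := by
      rintro rfl
      rw [Finset.HasAntidiagonal.mem_antidiagonal, zero_add] at hab
      exact hne (by rw [← hab])
    simp [slice_renameVars_castAdd, this]
  · simp

variable [IsNoetherianRing A]

lemma exists_sub_sum_slice_mem (f : restricted 𝔬 (m + n)) (e : ℕ) :
    ∃ s : Finset (Fin n →₀ ℕ),
      f - ∑ ν ∈ s, renameVars 𝔬 (Fin.castAddEmb n) (slice f ν) *
          MvPolynomial.aeval (indet 𝔬) (MvPolynomial.monomial (joinExp 0 ν) (1 : A)) ∈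
        (𝔬 ^ e).map (algebraMap A (restricted 𝔬 (m + n))) := by
  classical
  have finite_support :
      {ν : Fin n →₀ ℕ | ∃ μ : Fin m →₀ ℕ, coeff (joinExp μ ν) f.1 ∉ 𝔬 ^ e}.Finite := by
    refine ((f.2 e).image fun κ =>
      Finsupp.equivFunOnFinite.symm fun i => κ (Fin.natAdd m i)).subset ?_
    rintro ν ⟨μ, h⟩
    exact ⟨_, h, Finsupp.ext fun i => by simp [joinExp]⟩
  refine ⟨finite_support.toFinset, mem_map_pow_iff.2 fun κ => ?_⟩
  obtain ⟨μ, ν, rfl⟩ := exists_joinExp κ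
  let sliceHom : restricted 𝔬 (m + n) →+ restricted 𝔬 m :=
    AddMonoidHom.mk' (slice · ν) fun f g => slice_add f g ν
  change coeff μ (sliceHom (f - _)).1 ∈ _
  rw [map_sub, map_sum]
  simp only [sliceHom, AddMonoidHom.mk'_apply, slice_renameVars_castAdd_mul_monomial,
    Finset.sum_ite_eq]
  split_ifs with h
  · simp
  · simp only [Set.Finite.mem_toFinset, Set.mem_ofPred_eq, not_exists, not_not] at h
    rw [sub_zero]
    exact h μ

lemma mem_span_range_slice [IsAdicComplete 𝔬 A] (f : restricted 𝔬 (m + n)) :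
    f ∈ Ideal.span (Set.range fun ν => renameVars 𝔬 (Fin.castAddEmb n) (slice f ν)) := by
  set J := Ideal.span (Set.range fun ν => renameVars 𝔬 (Fin.castAddEmb n) (slice f ν))
  rw [← Ideal.Quotient.eq_zero_iff_mem]
  refine IsHausdorff.haus (inferInstance : IsHausdorff
    (𝔬.map (algebraMap A (restricted 𝔬 (m + n) ⧸ J))) _) _ fun e => ?_
  rw [SModEq.zero, smul_eq_mul, Ideal.mul_top, ← Ideal.map_pow]
  obtain ⟨s, hs⟩ := exists_sub_sum_slice_mem f e
  have sum_mem : ∑ ν ∈ s, renameVars 𝔬 (Fin.castAddEmb n) (slice f ν) *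
      MvPolynomial.aeval (indet 𝔬) (MvPolynomial.monomial (joinExp 0 ν) (1 : A)) ∈ J :=
    Ideal.sum_mem _ fun ν _ => Ideal.mul_mem_right _ _ (Ideal.subset_span ⟨ν, rfl⟩)
  have := Ideal.mem_map_of_mem (Ideal.Quotient.mk J) hs
  rwa [map_sub, Ideal.Quotient.eq_zero_iff_mem.2 sum_mem, sub_zero, Ideal.map_map] at this

end Slices

namespace AnalyticStructure

section Evaluation

variable {A : Type*} [CommRing A] {𝔬 : Ideal A} {R : Type*} [CommRing R]

/-- Evaluation of restricted series at the point `b`, as a ring morphism. -/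
noncomputable def evalAt (S : AnalyticStructure 𝔬 R) {N : ℕ} (b : Fin N → R) :
    restricted 𝔬 N →+* R :=
  (Pi.evalRingHom _ b).comp (S.iota N)

lemma evalAt_apply (S : AnalyticStructure 𝔬 R) {N : ℕ} (b : Fin N → R) (f : restricted 𝔬 N) :
    S.evalAt b f = S.iota N f b := rfl

@[simp]
lemma evalAt_indet (S : AnalyticStructure 𝔬 R) {N : ℕ} (b : Fin N → R) (i : Fin N) :
    S.evalAt b (indet 𝔬 i) = b i :=
  S.iota_indet N i b

lemma exists_iota_castLE_eq (S : AnalyticStructure 𝔬 R) {M L : ℕ} (h : M ≤ L) (b : Fin M → R) :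
    ∃ z : Fin L → R, ∀ f, S.iota L (renameVars 𝔬 (Fin.castLEEmb h) f) z = S.iota M f b := by
  obtain ⟨k, rfl⟩ := Nat.exists_eq_add_of_le h
  refine ⟨Fin.append b 0, fun f => (S.iota_castAdd M k f _).trans ?_⟩
  simp

variable [IsNoetherianRing A] [IsAdicComplete 𝔬 A] (S : AnalyticStructure 𝔬 R)

lemma exists_common_point {M N : ℕ} (b : Fin M → R) (d : Fin N → R) :
    ∃ (L : ℕ) (z : Fin L → R) (φ : restricted 𝔬 M →ₐ[A] restricted 𝔬 L)
      (ψ : restricted 𝔬 N →ₐ[A] restricted 𝔬 L),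
      (∀ f, S.evalAt z (φ f) = S.evalAt b f) ∧ ∀ f, S.evalAt z (ψ f) = S.evalAt d f := by
  have hM : M ≤ M + N := Nat.le_add_right M N
  have hN : N ≤ M + N := Nat.le_add_left N M
  obtain ⟨b', hb'⟩ := S.exists_iota_castLE_eq hM b
  obtain ⟨d', hd'⟩ := S.exists_iota_castLE_eq hN d
  refine ⟨M + N + (M + N), Fin.append b' d',
    (subst fun i => indet 𝔬 (Fin.castAddEmb _ i)).comp
      (subst fun i => indet 𝔬 (Fin.castLEEmb hM i)),
    (subst fun i => indet 𝔬 (Fin.natAddEmb _ i)).comp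
      (subst fun i => indet 𝔬 (Fin.castLEEmb hN i)),
    fun f => ?_, fun f => ?_⟩
  · rw [AlgHom.comp_apply, ← renameVars_eq_subst, ← renameVars_eq_subst, evalAt_apply, iota_castAdd,
      evalAt_apply, ← hb']
    simp only [Fin.append_left]
  · rw [AlgHom.comp_apply, ← renameVars_eq_subst, ← renameVars_eq_subst, evalAt_apply, ← iota_shift,
      evalAt_apply, ← hd']
    simp only [Fin.append_right]

lemma evalAt_subst {M N : ℕ} (b : Fin M → R) (c : Fin N → restricted 𝔬 M) (f : restricted 𝔬 N) :
    S.evalAt b (subst c f) = S.evalAt (fun i => S.evalAt b (c i)) f := by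
  obtain ⟨L, z, φ, ψ, hφ, hψ⟩ := S.exists_common_point b fun i => S.evalAt b (c i)
  have := algHom_sub_algHom_mem (φ := φ.comp (subst c)) (ψ := ψ) (J := RingHom.ker (S.evalAt z))
    (fun i => by simp [RingHom.mem_ker, hφ, hψ]) f
  rwa [RingHom.mem_ker, map_sub, sub_eq_zero, AlgHom.comp_apply, hφ, hψ] at this

lemma evalAt_renameVars {M N : ℕ} (e : Fin M ↪ Fin N) (b : Fin N → R) (f : restricted 𝔬 M) :
    S.evalAt b (renameVars 𝔬 e f) = S.evalAt (fun i => b (e i)) f := by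
  rw [renameVars_eq_subst, evalAt_subst]
  simp only [evalAt_indet]

lemma evalAt_algebraMap {N : ℕ} (b : Fin N → R) (a : A) :
    S.evalAt b (algebraMap A (restricted 𝔬 N) a) = S.structMap a := by
  rw [← AlgHom.commutes (subst (Fin.elim0 : Fin 0 → restricted 𝔬 N)), evalAt_subst,
    Subsingleton.elim (fun i => S.evalAt b _) Fin.elim0]
  rfl

lemma evalAt_mem_map_structMap {N : ℕ} (b : Fin N → R) {f : restricted 𝔬 N}
    (hf : f ∈ 𝔬.map (algebraMap A (restricted 𝔬 N))) : S.evalAt b f ∈ 𝔬.map S.structMap := by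
  have := Ideal.mem_map_of_mem (S.evalAt b) hf
  rwa [Ideal.map_map, show (S.evalAt b).comp (algebraMap A (restricted 𝔬 N)) = S.structMap from
    RingHom.ext (S.evalAt_algebraMap b)] at this

lemma evalAt_sub_evalAt_mem {N : ℕ} {I : Ideal R} {b c : Fin N → R} (h : ∀ i, b i - c i ∈ I)
    (f : restricted 𝔬 N) : S.evalAt b f - S.evalAt c f ∈ I := by
  have := algHom_sub_algHom_mem (J := I.comap (S.evalAt (Fin.append b c)))
    (φ := subst fun i => indet 𝔬 (Fin.castAdd N i)) (ψ := subst fun i => indet 𝔬 (Fin.natAdd N i))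
    (fun i => by
      simpa only [subst_indet, Ideal.mem_comap, map_sub, evalAt_indet, Fin.append_left,
        Fin.append_right] using h i) f
  simpa only [Ideal.mem_comap, map_sub, evalAt_subst, evalAt_indet, Fin.append_left,
    Fin.append_right] using this

/- Every element of `𝔬 R` is the value of an element of `𝔬 A⟨W⟩`, which lies in the Jacobson radical
because `A⟨W⟩` is `𝔬`-adically complete. -/
lemma map_structMap_le_jacobson_bot : 𝔬.map S.structMap ≤ Ideal.jacobson ⊥ := by
  intro z hz
  refine Ideal.mem_jacobson_bot.2 fun y => ?_
  obtain ⟨N, b, a, hab⟩ := Submodule.mem_span_set'.1 (Ideal.mul_mem_right y _ hz)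
  choose a' ha' h_struct using fun i => (a i).2
  let w : restricted 𝔬 N := ∑ i, indet 𝔬 i * algebraMap A _ (a' i)
  have evalAt_w : S.evalAt b w = z * y := by
    simpa [w, evalAt_algebraMap, h_struct] using hab
  have w_mem : w ∈ 𝔬.map (algebraMap A (restricted 𝔬 N)) := Ideal.sum_mem _ fun i _ =>
    Ideal.mul_mem_left _ _ (Ideal.mem_map_of_mem _ (ha' i))
  have isUnit_w : IsUnit (w + 1) := by
    simpa using Ideal.mem_jacobson_bot.1 (IsAdicComplete.le_jacobson_bot _ w_mem) 1
  simpa [evalAt_w] using isUnit_w.map (S.evalAt b)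

end Evaluation

section Extends

variable {A : Type*} [CommRing A] {𝔬 : Ideal A} {R R' : Type*} [CommRing R] [CommRing R']
  [Algebra R R'] {S' : AnalyticStructure 𝔬 R'} {S : AnalyticStructure 𝔬 R}

lemma Extends.evalAt_algebraMap (h : S'.Extends S) {N : ℕ} (b : Fin N → R) (f : restricted 𝔬 N) :
    S'.evalAt (fun i => algebraMap R R' (b i)) f = algebraMap R R' (S.evalAt b f) :=
  h N f b

lemma Extends.algebraMap_structMap (h : S'.Extends S) (a : A) :
    algebraMap R R' (S.structMap a) = S'.structMap a :=
  (h.evalAt_algebraMap Fin.elim0 (constants 𝔬 0 a)).symm.trans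
    (congrArg (S'.evalAt · (constants 𝔬 0 a)) (Subsingleton.elim _ _))

end Extends

section Constructions

variable {A : Type*} [CommRing A] [IsNoetherianRing A] {𝔬 : Ideal A} [IsAdicComplete 𝔬 A]
  {R : Type*} [CommRing R]

/-- An `A`-analytic structure from evaluation morphisms that are compatible with substitution;
conversely every `A`-analytic structure has this compatibility, by `evalAt_subst`. -/
noncomputable def ofSubst (op : ∀ {N : ℕ}, (Fin N → R) → restricted 𝔬 N →+* R)
    (op_indet : ∀ {N : ℕ} (b : Fin N → R) (i : Fin N), op b (indet 𝔬 i) = b i)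
    (op_subst : ∀ {M N : ℕ} (b : Fin M → R) (c : Fin N → restricted 𝔬 M) (f : restricted 𝔬 N),
      op b (subst c f) = op (fun i => op b (c i)) f) : AnalyticStructure 𝔬 R where
  iota N := RingHom.pi fun b => op b
  iota_indet N k y := op_indet y k
  iota_castSucc N f y := by
    simp only [RingHom.pi_apply, renameVars_eq_subst, op_subst, op_indet, Fin.castSuccEmb_apply]
  iota_shift N f y := by
    simp only [RingHom.pi_apply, renameVars_eq_subst, op_subst, op_indet, Fin.natAddEmb_apply]

/-- The `A`-analytic structure of the quotient of a ring by an arbitrary ideal. -/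
noncomputable def quotient (S : AnalyticStructure 𝔬 R) (I : Ideal R) :
    AnalyticStructure 𝔬 (R ⧸ I) :=
  ofSubst (fun b => (Ideal.Quotient.mk I).comp (S.evalAt fun i => (b i).out))
    (by simp) fun b c f => by
      rw [RingHom.comp_apply, evalAt_subst]
      exact Ideal.Quotient.eq.2 (S.evalAt_sub_evalAt_mem
        (fun i => Ideal.Quotient.eq.1 (by simp)) f)

lemma quotient_evalAt_mk (S : AnalyticStructure 𝔬 R) (I : Ideal R) {N : ℕ} (b : Fin N → R)
    (f : restricted 𝔬 N) :
    (S.quotient I).evalAt (fun i => Ideal.Quotient.mk I (b i)) f =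
      Ideal.Quotient.mk I (S.evalAt b f) :=
  Ideal.Quotient.eq.2 (S.evalAt_sub_evalAt_mem (fun i => Ideal.Quotient.eq.1 (by simp)) f)

lemma Extends.quotient {R' : Type*} [CommRing R'] [Algebra R R'] {S' : AnalyticStructure 𝔬 R'}
    {S : AnalyticStructure 𝔬 R} (h : S'.Extends S) (I : Ideal R') : (S'.quotient I).Extends S :=
  fun N f y => (S'.quotient_evalAt_mk I (fun i => algebraMap R R' (y i)) f).trans
    (congrArg (Ideal.Quotient.mk I) (h N f y))

end Constructions

section Spec

variable {A : Type*} [CommRing A] {𝔬 : Ideal A} {R : Type*} [CommRing R]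
  (S : AnalyticStructure 𝔬 R) {m n : ℕ}

lemma specialize_renameVars_castAdd (x : Fin m → R) (f : restricted 𝔬 m) :
    S.specialize (renameVars 𝔬 (Fin.castAddEmb n) f) x = C (S.evalAt x f) := by
  classical
  ext ν
  rw [coeff_specialize, slice_renameVars_castAdd, coeff_C]
  split_ifs <;> simp [evalAt_apply]

lemma specialize_indet_natAdd (x : Fin m → R) (l : Fin n) :
    S.specialize (indet 𝔬 (Fin.natAdd m l)) x = X l := by
  classical
  have joinExp_single : joinExp (0 : Fin m →₀ ℕ) (Finsupp.single l 1) =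
      Finsupp.single (Fin.natAdd m l) 1 := by
    ext i
    refine Fin.addCases (fun i => ?_) (fun i => ?_) i
    · have : Fin.natAdd m l ≠ Fin.castAdd n i := by
        rw [Ne, Fin.ext_iff, Fin.val_natAdd, Fin.val_castAdd]
        omega
      simp [joinExp, Finsupp.single_eq_of_ne' this]
    · simp [joinExp, Finsupp.single_apply]
  have indet_eq : indet 𝔬 (Fin.natAdd m l) = MvPolynomial.aeval (indet 𝔬)
      (MvPolynomial.monomial (joinExp (0 : Fin m →₀ ℕ) (Finsupp.single l 1)) (1 : A)) := by
    rw [joinExp_single, ← MvPolynomial.X, MvPolynomial.aeval_X]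
  ext ν
  rw [coeff_specialize, indet_eq, slice_aeval_monomial_joinExp, coeff_X]
  split_ifs <;> simp

/-- The morphism `A⟨X, Y⟩ → R⟨Y⟩`, `f ↦ f(x, Y)`. -/
noncomputable def spec (x : Fin m → R) : restricted 𝔬 (m + n) →+* S.series n where
  toFun f := ⟨S.specialize f x, m, f, x, rfl⟩
  map_one' := Subtype.ext <| by
    simpa using S.specialize_renameVars_castAdd (n := n) x (1 : restricted 𝔬 m)
  map_mul' f g := Subtype.ext (S.specialize_mul f g x)
  map_zero' := Subtype.ext <| by
    simpa using S.specialize_renameVars_castAdd (n := n) x (0 : restricted 𝔬 m)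
  map_add' f g := Subtype.ext (S.specialize_add f g x)

noncomputable instance : Algebra R (S.series n) :=
  ((C : R →+* MvPowerSeries (Fin n) R).codRestrict _ (S.C_mem_series n)).toAlgebra

lemma series.coe_algebraMap (a : R) :
    (algebraMap R (S.series n) a : MvPowerSeries (Fin n) R) = C a := rfl

/-- The indeterminate `Y_l` in `R⟨Y₁, …, Yₙ⟩`. -/
noncomputable def seriesX (l : Fin n) : S.series n :=
  ⟨X l, 0, indet 𝔬 (Fin.natAdd 0 l), Fin.elim0, S.specialize_indet_natAdd _ l⟩

lemma spec_renameVars_castAdd (x : Fin m → R) (f : restricted 𝔬 m) :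
    S.spec x (renameVars 𝔬 (Fin.castAddEmb n) f) = algebraMap R (S.series n) (S.evalAt x f) :=
  Subtype.ext (S.specialize_renameVars_castAdd x f)

lemma spec_indet_natAdd (x : Fin m → R) (l : Fin n) :
    S.spec x (indet 𝔬 (Fin.natAdd m l)) = S.seriesX l :=
  Subtype.ext (S.specialize_indet_natAdd x l)

lemma spec_indet_castAdd (x : Fin m → R) (i : Fin m) :
    S.spec x (indet 𝔬 (Fin.castAdd n i)) = algebraMap R (S.series n) (x i) := by
  have : renameVars 𝔬 (Fin.castAddEmb n) (indet 𝔬 i) = indet 𝔬 (Fin.castAdd n i) :=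
    Subtype.ext (rename_X _ i)
  rw [← this, spec_renameVars_castAdd, evalAt_indet]

lemma evalAt_slice_eq_coeff_spec (x : Fin m → R) (f : restricted 𝔬 (m + n)) (ν : Fin n →₀ ℕ) :
    S.evalAt x (slice f ν) = coeff ν (S.spec x f).1 := rfl

lemma exists_spec_eq (g : S.series n) :
    ∃ (m : ℕ) (x : Fin m → R) (f : restricted 𝔬 (m + n)), S.spec x f = g := by
  obtain ⟨g, m, f, x, h⟩ := g
  exact ⟨m, x, f, Subtype.ext h⟩

variable [IsNoetherianRing A] [IsAdicComplete 𝔬 A]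

lemma spec_renameVars_padEmb {m' : ℕ} (e : Fin m ↪ Fin m') (x : Fin m' → R)
    (f : restricted 𝔬 (m + n)) :
    S.spec x (renameVars 𝔬 (padEmb n e) f) = S.spec (fun i => x (e i)) f :=
  Subtype.ext (S.specialize_rename e x (S.evalAt_renameVars e x) f)

lemma exists_common_spec_eq {ι : Type*} [Finite ι] (g : ι → S.series n) :
    ∃ (m : ℕ) (x : Fin m → R) (f : ι → restricted 𝔬 (m + n)), ∀ i, S.spec x (f i) = g i := by
  have := Fintype.ofFinite ι
  choose m x f hf using fun i => S.exists_spec_eq (g i)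
  let ε := Fintype.equivFin (Σ i, Fin (m i))
  refine ⟨_, fun k => x _ (ε.symm k).2, fun i =>
    renameVars 𝔬 (padEmb n ((Function.Embedding.sigmaMk i).trans ε.toEmbedding)) (f i), fun i => ?_⟩
  rw [spec_renameVars_padEmb, ← hf]
  refine congrArg (fun y => S.spec y (f i)) (funext fun j => ?_)
  exact congrArg (fun p : Σ i, Fin (m i) => x p.1 p.2) (ε.symm_apply_apply ⟨i, j⟩)

lemma spec_subst_eq_spec_subst {m' N : ℕ} {x : Fin m → R} {x' : Fin m' → R}
    {g : Fin N → restricted 𝔬 (m + n)} {g' : Fin N → restricted 𝔬 (m' + n)}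
    (h : ∀ i, S.spec x (g i) = S.spec x' (g' i)) (f : restricted 𝔬 N) :
    S.spec x (subst g f) = S.spec x' (subst g' f) := by
  let z := Fin.append x x'
  have spec_left (u : restricted 𝔬 (m + n)) :
      S.spec z (subst (fun i => indet 𝔬 (padEmb n (Fin.castAddEmb m') i)) u) = S.spec x u := by
    rw [← renameVars_eq_subst, spec_renameVars_padEmb]
    simp [z]
  have spec_right (u : restricted 𝔬 (m' + n)) :
      S.spec z (subst (fun i => indet 𝔬 (padEmb n (Fin.natAddEmb m) i)) u) = S.spec x' u := by
    rw [← renameVars_eq_subst, spec_renameVars_padEmb]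
    simp [z]
  have := algHom_sub_algHom_mem (J := RingHom.ker (S.spec z))
    (φ := (subst fun i => indet 𝔬 (padEmb n (Fin.castAddEmb m') i)).comp (subst g))
    (ψ := (subst fun i => indet 𝔬 (padEmb n (Fin.natAddEmb m) i)).comp (subst g'))
    (fun i => by
      simp only [AlgHom.comp_apply, subst_indet, RingHom.mem_ker, map_sub, spec_left, spec_right,
        h, sub_self]) f
  rwa [RingHom.mem_ker, map_sub, sub_eq_zero, AlgHom.comp_apply, AlgHom.comp_apply, spec_left,
    spec_right] at this

lemma exists_ringHom_eq_spec_subst {N : ℕ} (d : Fin N → S.series n) :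
    ∃ φ : restricted 𝔬 N →+* S.series n, ∀ (m : ℕ) (x : Fin m → R)
      (g : Fin N → restricted 𝔬 (m + n)), (∀ i, S.spec x (g i) = d i) →
        ∀ f, φ f = S.spec x (subst g f) := by
  obtain ⟨m, x, g, hg⟩ := S.exists_common_spec_eq d
  exact ⟨(S.spec x).comp (subst g : _ →ₐ[A] _).toRingHom, fun m' x' g' hg' f =>
    S.spec_subst_eq_spec_subst (fun i => (hg i).trans (hg' i).symm) f⟩

variable (n) in
/-- The `A`-analytic structure of `R⟨Y⟩`, given by
`f(g₁(x, Y), …, g_N(x, Y)) = f(g₁, …, g_N)(x, Y)`. -/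
noncomputable def onSeries : AnalyticStructure 𝔬 (S.series n) :=
  ofSubst (fun d => (S.exists_ringHom_eq_spec_subst d).choose)
    (fun d i => by
      obtain ⟨m, x, g, hg⟩ := S.exists_common_spec_eq d
      rw [(S.exists_ringHom_eq_spec_subst d).choose_spec m x g hg, subst_indet, hg])
    fun d c f => by
      obtain ⟨m, x, g, hg⟩ := S.exists_common_spec_eq d
      rw [(S.exists_ringHom_eq_spec_subst d).choose_spec m x g hg, algHom_subst]
      exact ((S.exists_ringHom_eq_spec_subst _).choose_spec m x _
        (fun i => ((S.exists_ringHom_eq_spec_subst d).choose_spec m x g hg (c i)).symm) f).symm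

lemma onSeries_evalAt_spec {N : ℕ} (x : Fin m → R) (g : Fin N → restricted 𝔬 (m + n))
    (f : restricted 𝔬 N) :
    (S.onSeries n).evalAt (fun i => S.spec x (g i)) f = S.spec x (subst g f) :=
  (S.exists_ringHom_eq_spec_subst _).choose_spec m x g (fun _ => rfl) f

variable (n) in
lemma onSeries_extends : (S.onSeries n).Extends S := fun N f y => by
  have := S.onSeries_evalAt_spec y (fun i => indet 𝔬 (Fin.castAddEmb n i)) f
  rw [← renameVars_eq_subst, spec_renameVars_castAdd] at this
  simp only [Fin.castAddEmb_apply, spec_indet_castAdd] at this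
  exact this

lemma onSeries_evalAt_append_seriesX (x : Fin m → R) (f : restricted 𝔬 (m + n)) :
    (S.onSeries n).evalAt (Fin.append (fun i => algebraMap R (S.series n) (x i)) S.seriesX) f =
      S.spec x f := by
  have spec_indet : (fun i => S.spec x (indet 𝔬 i)) =
      Fin.append (fun i => algebraMap R (S.series n) (x i)) S.seriesX := by
    refine funext (Fin.addCases (fun i => ?_) fun i => ?_)
    · rw [spec_indet_castAdd, Fin.append_left]
    · rw [spec_indet_natAdd, Fin.append_right]
  rw [← spec_indet, onSeries_evalAt_spec, subst_self_indet]

end Spec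

section SeriesLift

variable {A : Type*} [CommRing A] [IsNoetherianRing A] {𝔬 : Ideal A} [IsAdicComplete 𝔬 A]
  {R B : Type*} [CommRing R] [CommRing B] [Algebra R B] {S : AnalyticStructure 𝔬 R}
  {T : AnalyticStructure 𝔬 B} {m n : ℕ}

/- `f` lies in the ideal of `A⟨X, Y⟩` generated by its coefficients `f_ν(X)`, which vanish at
`x`. -/
lemma Extends.evalAt_append_eq_zero (hT : T.Extends S) {x : Fin m → R} {f : restricted 𝔬 (m + n)}
    (hf : S.spec x f = 0) (b : Fin n → B) :
    T.evalAt (Fin.append (fun i => algebraMap R B (x i)) b) f = 0 := by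
  suffices h : Ideal.span (Set.range fun ν => renameVars 𝔬 (Fin.castAddEmb n) (slice f ν)) ≤
      RingHom.ker (T.evalAt (Fin.append (fun i => algebraMap R B (x i)) b)) from
    h (mem_span_range_slice f)
  rw [Ideal.span_le]
  rintro _ ⟨ν, rfl⟩
  rw [SetLike.mem_coe, RingHom.mem_ker, evalAt_renameVars]
  simp only [Fin.castAddEmb_apply, Fin.append_left]
  rw [hT.evalAt_algebraMap, evalAt_slice_eq_coeff_spec, hf, ZeroMemClass.coe_zero, map_zero,
    map_zero]

lemma evalAt_append_renameVars_padEmb {m' : ℕ} (e : Fin m ↪ Fin m') (x : Fin m' → R)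
    (b : Fin n → R) (f : restricted 𝔬 (m + n)) :
    S.evalAt (Fin.append x b) (renameVars 𝔬 (padEmb n e) f) =
      S.evalAt (Fin.append (fun i => x (e i)) b) f := by
  rw [evalAt_renameVars]
  congr 2
  refine funext (Fin.addCases (fun i => ?_) fun i => ?_) <;> simp [padEmb]

lemma Extends.evalAt_append_eq_of_spec_eq (hT : T.Extends S) {m' : ℕ} {x : Fin m → R}
    {x' : Fin m' → R} {f : restricted 𝔬 (m + n)} {f' : restricted 𝔬 (m' + n)}
    (h : S.spec x f = S.spec x' f') (b : Fin n → B) :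
    T.evalAt (Fin.append (fun i => algebraMap R B (x i)) b) f =
      T.evalAt (Fin.append (fun i => algebraMap R B (x' i)) b) f' := by
  have := hT.evalAt_append_eq_zero (x := Fin.append x x')
    (f := renameVars 𝔬 (padEmb n (Fin.castAddEmb m')) f -
      renameVars 𝔬 (padEmb n (Fin.natAddEmb m)) f') ?_ b
  · simpa only [map_sub, evalAt_append_renameVars_padEmb, Fin.castAddEmb_apply, Fin.natAddEmb_apply,
      Fin.append_left, Fin.append_right, sub_eq_zero] using this
  · simp only [map_sub, spec_renameVars_padEmb, Fin.castAddEmb_apply, Fin.natAddEmb_apply,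
      Fin.append_left, Fin.append_right, h, sub_self]

lemma Extends.exists_algHom_spec_eq (hT : T.Extends S) (b : Fin n → B) :
    ∃ φ : S.series n →ₐ[R] B, ∀ (m : ℕ) (x : Fin m → R) (f : restricted 𝔬 (m + n)),
      φ (S.spec x f) = T.evalAt (Fin.append (fun i => algebraMap R B (x i)) b) f := by
  choose φ hφ using fun g : S.series n =>
    show ∃ c : B, ∀ (m : ℕ) (x : Fin m → R) (f : restricted 𝔬 (m + n)), S.spec x f = g →
        c = T.evalAt (Fin.append (fun i => algebraMap R B (x i)) b) f by
      obtain ⟨m, x, f, rfl⟩ := S.exists_spec_eq g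
      exact ⟨_, fun m' x' f' h => hT.evalAt_append_eq_of_spec_eq h.symm b⟩
  have exists_common (g g' : S.series n) : ∃ (m : ℕ) (x : Fin m → R) (f f' : restricted 𝔬 (m + n)),
      S.spec x f = g ∧ S.spec x f' = g' := by
    obtain ⟨m, x, f, hf⟩ := S.exists_common_spec_eq ![g, g']
    exact ⟨m, x, f 0, f 1, hf 0, hf 1⟩
  have map_algebraMap (a : R) : φ (algebraMap R (S.series n) a) = algebraMap R B a := by
    rw [hφ _ 1 (fun _ => a) _ (S.spec_indet_castAdd (fun _ => a) 0), evalAt_indet, Fin.append_left]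
  have map_one : φ 1 = 1 := by simpa using map_algebraMap 1
  have map_zero : φ 0 = 0 := by simpa using map_algebraMap 0
  have map_mul (g g' : S.series n) : φ (g * g') = φ g * φ g' := by
    obtain ⟨m, x, f, f', hf, hf'⟩ := exists_common g g'
    rw [hφ _ m x f hf, hφ _ m x f' hf', ← RingHom.map_mul,
      hφ _ m x (f * f') (by rw [RingHom.map_mul, hf, hf'])]
  have map_add (g g' : S.series n) : φ (g + g') = φ g + φ g' := by
    obtain ⟨m, x, f, f', hf, hf'⟩ := exists_common g g'
    rw [hφ _ m x f hf, hφ _ m x f' hf', ← RingHom.map_add,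
      hφ _ m x (f + f') (by rw [RingHom.map_add, hf, hf'])]
  exact ⟨⟨⟨⟨⟨φ, map_one⟩, map_mul⟩, map_zero, map_add⟩, map_algebraMap⟩,
    fun m x f => hφ _ m x f rfl⟩

/-- The universal property of `R⟨Y⟩` among `R`-algebras `B` whose `A`-analytic structure extends
that of `R`: the morphism `g ↦ g(b)` for `b ∈ B ^ n`. -/
noncomputable def Extends.seriesLift (hT : T.Extends S) (b : Fin n → B) : S.series n →ₐ[R] B :=
  (hT.exists_algHom_spec_eq b).choose

lemma Extends.seriesLift_spec (hT : T.Extends S) (b : Fin n → B) (x : Fin m → R)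
    (f : restricted 𝔬 (m + n)) : hT.seriesLift b (S.spec x f) =
      T.evalAt (Fin.append (fun i => algebraMap R B (x i)) b) f :=
  (hT.exists_algHom_spec_eq b).choose_spec m x f

@[simp]
lemma Extends.seriesLift_seriesX (hT : T.Extends S) (b : Fin n → B) (l : Fin n) :
    hT.seriesLift b (S.seriesX l) = b l := by
  rw [← S.spec_indet_natAdd Fin.elim0, seriesLift_spec, evalAt_indet, Fin.append_right]

lemma Extends.seriesLift_evalAt (hT : T.Extends S) (b : Fin n → B) {N : ℕ} (c : Fin N → S.series n)
    (f : restricted 𝔬 N) :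
    hT.seriesLift b ((S.onSeries n).evalAt c f) = T.evalAt (fun i => hT.seriesLift b (c i)) f := by
  obtain ⟨m, x, g, hg⟩ := S.exists_common_spec_eq c
  obtain rfl : (fun i => S.spec x (g i)) = c := funext hg
  simp only [onSeries_evalAt_spec, seriesLift_spec, evalAt_subst]

end SeriesLift

end AnalyticStructure

section Nakayama

instance isPrecomplete_pi {P ι : Type*} [CommRing P] [Finite ι] (𝔭 : Ideal P) [IsPrecomplete 𝔭 P] :
    IsPrecomplete 𝔭 (ι → P) := by
  classical
  have := Fintype.ofFinite ι
  refine AdicCompletion.of_surjective_iff.1 fun z => ?_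
  choose x hx using fun i =>
    AdicCompletion.of_surjective 𝔭 P (AdicCompletion.piEquivOfFintype 𝔭 (fun _ : ι => P) z i)
  refine ⟨x, (AdicCompletion.piEquivOfFintype 𝔭 fun _ : ι => P).injective (funext fun i => ?_)⟩
  rw [← hx, AdicCompletion.piEquivOfFintype_apply]
  rfl

lemma span_range_eq_top_of_isHausdorff {P M ι : Type*} [CommRing P] [AddCommGroup M] [Module P M]
    [Finite ι] {𝔭 : Ideal P} [IsPrecomplete 𝔭 P] [IsHausdorff 𝔭 M] {e : ι → M}
    (h : Submodule.span P (Set.range e) ⊔ 𝔭 • ⊤ = ⊤) : Submodule.span P (Set.range e) = ⊤ := by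
  have := Fintype.ofFinite ι
  rw [← Fintype.range_linearCombination P e] at h ⊢
  refine LinearMap.range_eq_top.2 (surjective_of_mkQ_comp_surjective (I := 𝔭) ?_)
  rw [← LinearMap.range_eq_top, LinearMap.range_comp, Submodule.map_mkQ_eq_top, sup_comm, h]

lemma span_range_sup_eq_top_of_le_jacobson {P Q ι : Type*} [CommRing P] [CommRing Q] [Algebra P Q]
    [IsNoetherianRing Q] [Finite ι] {𝔭 : Ideal P} [IsPrecomplete 𝔭 P]
    (h𝔭 : 𝔭.map (algebraMap P Q) ≤ Ideal.jacobson ⊥) {J : Ideal Q} {e : ι → Q}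
    (h : Submodule.span P (Set.range e) ⊔ (𝔭.map (algebraMap P Q) ⊔ J).restrictScalars P = ⊤) :
    Submodule.span P (Set.range e) ⊔ J.restrictScalars P = ⊤ := by
  have : IsHausdorff 𝔭 (Q ⧸ J) := IsHausdorff.map_algebraMap_iff.1
    (IsHausdorff.of_le_jacobson (𝔭.map (algebraMap P Q)) (Q ⧸ J) h𝔭)
  let q : Q →ₗ[P] Q ⧸ J := (Ideal.Quotient.mkₐ P J).toLinearMap
  have range_q : q.range = ⊤ := LinearMap.range_eq_top.2 Ideal.Quotient.mk_surjective
  have ker_q : q.ker = J.restrictScalars P := by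
    ext g
    exact Ideal.Quotient.eq_zero_iff_mem
  rw [Submodule.restrictScalars_sup, ← Ideal.smul_top_eq_map, ← sup_assoc, ← ker_q,
    ← LinearMap.map_eq_top_iff range_q, Submodule.map_sup, Submodule.map_smul'', Submodule.map_top,
    range_q] at h
  rw [← ker_q, ← LinearMap.map_eq_top_iff range_q]
  rw [Submodule.map_span, ← Set.range_comp] at h ⊢
  exact span_range_eq_top_of_isHausdorff h

lemma mem_span_range_sup_iff {P M ι : Type*} [CommRing P] [AddCommGroup M] [Module P M] [Fintype ι]
    {e : ι → M} {K : Submodule P M} {g : M} :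
    g ∈ Submodule.span P (Set.range e) ⊔ K ↔ ∃ c : ι → P, g - ∑ j, c j • e j ∈ K := by
  simp only [Submodule.mem_sup, Submodule.mem_span_range_iff_exists_fun]
  constructor
  · rintro ⟨_, ⟨c, rfl⟩, k, hk, rfl⟩
    exact ⟨c, by rwa [add_sub_cancel_left]⟩
  · rintro ⟨c, hc⟩
    exact ⟨_, ⟨c, rfl⟩, _, hc, add_sub_cancel _ _⟩

lemma mul_mem_span_range_sup {P Q ι : Type*} [CommRing P] [CommRing Q] [Algebra P Q] {K : Ideal Q}
    {e : ι → Q} {x : Q}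
    (h : ∀ j, x * e j ∈ Submodule.span P (Set.range e) ⊔ K.restrictScalars P) {g : Q}
    (hg : g ∈ Submodule.span P (Set.range e) ⊔ K.restrictScalars P) :
    x * g ∈ Submodule.span P (Set.range e) ⊔ K.restrictScalars P := by
  suffices h : Submodule.span P (Set.range e) ⊔ K.restrictScalars P ≤
      (Submodule.span P (Set.range e) ⊔ K.restrictScalars P).comap (LinearMap.mulLeft P x) from h hg
  refine sup_le (Submodule.span_le.2 ?_) fun k hk => Submodule.mem_sup_right (K.mul_mem_left x hk)
  rintro _ ⟨j, rfl⟩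
  exact h j

lemma sub_mem_sup_ker {Q D : Type*} [CommRing Q] [CommRing D] {π : Q →+* D} {𝔮 : Ideal Q}
    {f g w : Q} (hw : w ∈ 𝔮) (h : π f = π (g + w)) : f - g ∈ 𝔮 ⊔ RingHom.ker π := by
  rw [show f - g = w + (f - (g + w)) by ring]
  refine add_mem (Ideal.mem_sup_left hw) (Ideal.mem_sup_right ?_)
  rw [RingHom.mem_ker, map_sub, h, sub_self]

lemma exists_sum_mul_eq_of_mem_map {A D ι : Type*} [CommRing A] [CommRing D] [Fintype ι]
    {𝔬 : Ideal A} {a : ι → A} (ha : Ideal.span (Set.range a) = 𝔬) {φ : A →+* D} {d : D}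
    (hd : d ∈ 𝔬.map φ) : ∃ w : ι → D, ∑ i, w i * φ (a i) = d := by
  rw [← ha, Ideal.map_span, ← Set.range_comp, Ideal.mem_span_range_iff_exists_fun] at hd
  exact hd

lemma exists_eq_sum_smul_add_sum_mul {A C D ι κ : Type*} [CommRing A] [CommRing C] [CommRing D]
    [Algebra C D] [Fintype ι] [Fintype κ] {𝔬 : Ideal A} {a : κ → A}
    (ha : Ideal.span (Set.range a) = 𝔬) {φ : A →+* D} {e : ι → D}
    (he : Submodule.span C (Set.range e) ⊔ (𝔬.map φ).restrictScalars C = ⊤) (d : D) :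
    ∃ (c : ι → C) (w : κ → D), d = ∑ j, c j • e j + ∑ i, w i * φ (a i) := by
  obtain ⟨c, hc⟩ := mem_span_range_sup_iff.1 (he.ge (Submodule.mem_top (x := d)))
  obtain ⟨w, hw⟩ := exists_sum_mul_eq_of_mem_map ha hc
  exact ⟨c, w, by rw [hw, add_sub_cancel]⟩

variable {A : Type*} [CommRing A] [IsNoetherianRing A] {𝔬 : Ideal A}

lemma eq_top_of_indet_mul_mem {N : ℕ} {G : Submodule A (restricted 𝔬 N)}
    (map_le : (𝔬.map (algebraMap A (restricted 𝔬 N))).restrictScalars A ≤ G) (one_mem : 1 ∈ G)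
    (indet_mul_mem : ∀ i, ∀ g ∈ G, indet 𝔬 i * g ∈ G) : G = ⊤ := by
  have aeval_mem (p : MvPolynomial (Fin N) A) : MvPolynomial.aeval (indet 𝔬) p ∈ G := by
    induction p using MvPolynomial.induction_on with
    | C a =>
      rw [MvPolynomial.aeval_C, Algebra.algebraMap_eq_smul_one]
      exact G.smul_mem a one_mem
    | add p q hp hq => simpa only [map_add] using add_mem hp hq
    | mul_X p i hp =>
      simpa only [map_mul, MvPolynomial.aeval_X, mul_comm] using indet_mul_mem i _ hp
  refine eq_top_iff.2 fun f _ => ?_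
  obtain ⟨p, hp⟩ := exists_sub_aeval_indet_mem f 1
  rw [← sub_add_cancel f (MvPolynomial.aeval (indet 𝔬) p)]
  rw [pow_one] at hp
  exact add_mem (map_le hp) (aeval_mem p)

lemma span_range_sup_eq_top_of_indet_mul_mem [IsAdicComplete 𝔬 A] {P ι : Type*} {N : ℕ} [CommRing P]
    [Algebra A P] [IsPrecomplete (𝔬.map (algebraMap A P)) P] [Algebra P (restricted 𝔬 N)]
    [IsScalarTower A P (restricted 𝔬 N)] [Finite ι] {J : Ideal (restricted 𝔬 N)}
    {e : ι → restricted 𝔬 N}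
    (one_mem : 1 ∈ Submodule.span P (Set.range e) ⊔
      (𝔬.map (algebraMap A (restricted 𝔬 N)) ⊔ J).restrictScalars P)
    (indet_mul_mem : ∀ i j, indet 𝔬 i * e j ∈ Submodule.span P (Set.range e) ⊔
      (𝔬.map (algebraMap A (restricted 𝔬 N)) ⊔ J).restrictScalars P) :
    Submodule.span P (Set.range e) ⊔ J.restrictScalars P = ⊤ := by
  have map_map : (𝔬.map (algebraMap A P)).map (algebraMap P (restricted 𝔬 N)) =
      𝔬.map (algebraMap A (restricted 𝔬 N)) := by
    rw [Ideal.map_map, ← IsScalarTower.algebraMap_eq]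
  refine span_range_sup_eq_top_of_le_jacobson (𝔭 := 𝔬.map (algebraMap A P))
    (map_map ▸ IsAdicComplete.le_jacobson_bot _) ?_
  rw [map_map, ← Submodule.restrictScalars_eq_top_iff A]
  exact eq_top_of_indet_mul_mem
    (fun g hg => Submodule.mem_sup_right (le_sup_left (b := J) hg)) one_mem
    fun i g hg => mul_mem_span_range_sup (indet_mul_mem i) hg

lemma exists_sub_sum_renameVars_mul_mem [IsAdicComplete 𝔬 A] {ι : Type*} [Fintype ι] {m n : ℕ}
    {J : Ideal (restricted 𝔬 (m + n))} {e : ι → restricted 𝔬 (m + n)}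
    (h_one : ∃ c : ι → restricted 𝔬 m, 1 - ∑ j, renameVars 𝔬 (Fin.castAddEmb n) (c j) * e j ∈
      𝔬.map (algebraMap A (restricted 𝔬 (m + n))) ⊔ J)
    (h_indet : ∀ l i, ∃ c : ι → restricted 𝔬 m, indet 𝔬 (Fin.natAdd m l) * e i -
      ∑ j, renameVars 𝔬 (Fin.castAddEmb n) (c j) * e j ∈
        𝔬.map (algebraMap A (restricted 𝔬 (m + n))) ⊔ J) (f : restricted 𝔬 (m + n)) :
    ∃ c : ι → restricted 𝔬 m, f - ∑ j, renameVars 𝔬 (Fin.castAddEmb n) (c j) * e j ∈ J := by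
  let _ : Algebra (restricted 𝔬 m) (restricted 𝔬 (m + n)) :=
    (renameVars 𝔬 (Fin.castAddEmb n)).toAlgebra
  have : IsScalarTower A (restricted 𝔬 m) (restricted 𝔬 (m + n)) :=
    IsScalarTower.of_algebraMap_eq fun a => Subtype.ext (rename_C (Fin.castAddEmb n) a).symm
  refine mem_span_range_sup_iff.1 ((span_range_sup_eq_top_of_indet_mul_mem (J := J)
    (mem_span_range_sup_iff.2 h_one) fun i j => ?_).ge (Submodule.mem_top (x := f)))
  revert i
  refine Fin.addCases (fun i => ?_) fun l => mem_span_range_sup_iff.2 (h_indet l j)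
  have : indet 𝔬 (Fin.castAdd n i) = algebraMap (restricted 𝔬 m) _ (indet 𝔬 i) :=
    Subtype.ext (rename_X _ i).symm
  rw [this, ← Algebra.smul_def]
  exact Submodule.mem_sup_left (Submodule.smul_mem _ _ (Submodule.subset_span ⟨j, rfl⟩))

namespace AnalyticStructure

variable [IsAdicComplete 𝔬 A]

lemma exists_common_evalAt_eq_spec_eq {R : Type*} [CommRing R] (S : AnalyticStructure 𝔬 R) {n : ℕ}
    {ι κ : Type*} [Finite ι] [Finite κ] (c : κ → R) (g : ι → S.series n) :
    ∃ (m : ℕ) (x : Fin m → R) (h : κ → restricted 𝔬 m) (f : ι → restricted 𝔬 (m + n)),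
      (∀ k, S.evalAt x (h k) = c k) ∧ ∀ i, S.spec x (f i) = g i := by
  obtain ⟨m, x, f, hf⟩ := S.exists_common_spec_eq (Sum.elim (fun k => algebraMap R _ (c k)) g)
  refine ⟨m, x, fun k => slice (f (.inl k)) 0, fun i => f (.inr i), fun k => ?_, fun i => hf _⟩
  rw [evalAt_slice_eq_coeff_spec, hf]
  exact coeff_zero_C (c k)

lemma Extends.exists_common_lift {C D : Type*} [CommRing C] [CommRing D] [Algebra C D]
    {T : AnalyticStructure 𝔬 C} {T' : AnalyticStructure 𝔬 D} (hT : T'.Extends T) {n : ℕ}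
    {y : Fin n → D} (hy : Function.Surjective (hT.seriesLift y)) {ι κ : Type*} [Finite ι] [Finite κ]
    (c : κ → C) (d : ι → D) :
    ∃ (m : ℕ) (ρ : restricted 𝔬 m →+* C) (π : restricted 𝔬 (m + n) →+* D)
      (h : κ → restricted 𝔬 m) (f : ι → restricted 𝔬 (m + n)),
      (∀ u, π (renameVars 𝔬 (Fin.castAddEmb n) u) = algebraMap C D (ρ u)) ∧
      (∀ l, π (indet 𝔬 (Fin.natAdd m l)) = y l) ∧
      (∀ a, π (algebraMap A _ a) = T'.structMap a) ∧ (∀ k, ρ (h k) = c k) ∧ ∀ i, π (f i) = d i := by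
  choose lift hlift using hy
  obtain ⟨m, x, h, f, hh, hf⟩ := T.exists_common_evalAt_eq_spec_eq c fun i => lift (d i)
  refine ⟨m, T.evalAt x, (hT.seriesLift y).toRingHom.comp (T.spec x), h, f,
    fun u => ?_, fun l => ?_, fun a => ?_, hh, fun i => ?_⟩
  · exact (congrArg _ (T.spec_renameVars_castAdd x u)).trans ((hT.seriesLift y).commutes _)
  · exact (congrArg _ (T.spec_indet_natAdd x l)).trans (hT.seriesLift_seriesX y l)
  · exact (hT.seriesLift_spec y x _).trans (T'.evalAt_algebraMap _ a)
  · exact (congrArg _ (hf i)).trans (hlift _)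

/- This is Nakayama's lemma. Although `D` is not `𝔬`-adically complete, finitely many relations over
`C` lift to a ring `A⟨X, Y⟩`, whose quotients are. -/
theorem Extends.span_range_eq_top {C D ι : Type*} [CommRing C] [CommRing D] [Algebra C D]
    {T : AnalyticStructure 𝔬 C} {T' : AnalyticStructure 𝔬 D} (hT : T'.Extends T) [Finite ι] {n : ℕ}
    {y : Fin n → D} (hy : Function.Surjective (hT.seriesLift y)) {e : ι → D}
    (he : Submodule.span C (Set.range e) ⊔ (𝔬.map T'.structMap).restrictScalars C = ⊤) :
    Submodule.span C (Set.range e) = ⊤ := by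
  have := Fintype.ofFinite ι
  obtain ⟨r, a, ha⟩ := Submodule.fg_iff_exists_fin_generating_family.1 (IsNoetherian.noetherian 𝔬)
  refine eq_top_iff.2 fun d _ => ?_
  let v : Option (Fin n × ι) → D := fun k => k.elim 1 fun p => y p.1 * e p.2
  choose c w hv using fun k => exists_eq_sum_smul_add_sum_mul ha he (v k)
  obtain ⟨m, ρ, π, h, f, π_renameVars, π_indet, π_algebraMap, hh, hf⟩ :=
    hT.exists_common_lift hy (fun p : _ × ι => c p.1 p.2)
      (Sum.elim (fun _ : Unit => d) (Sum.elim e fun p : _ × Fin r => w p.1 p.2))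
  have π_d : π (f (.inl ())) = d := hf _
  have π_e (j : ι) : π (f (.inr (.inl j))) = e j := hf _
  have π_w (k) (i : Fin r) : π (f (.inr (.inr (k, i)))) = w k i := hf _
  have lift_relation (k) (V : restricted 𝔬 (m + n)) (hV : π V = v k) :
      V - ∑ j, renameVars 𝔬 (Fin.castAddEmb n) (h (k, j)) * f (.inr (.inl j)) ∈
        𝔬.map (algebraMap A (restricted 𝔬 (m + n))) ⊔ RingHom.ker π := by
    refine sub_mem_sup_ker (w := ∑ i, f (.inr (.inr (k, i))) * algebraMap A _ (a i))
      (sum_mem fun i _ => Ideal.mul_mem_left _ _ (Ideal.mem_map_of_mem _ ?_)) ?_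
    · exact ha.le (Submodule.subset_span ⟨i, rfl⟩)
    · simp only [hV, hv k, map_add, map_sum, map_mul, π_renameVars, hh, π_e, π_w, π_algebraMap,
        Algebra.smul_def]
  obtain ⟨H, hH⟩ := exists_sub_sum_renameVars_mul_mem (J := RingHom.ker π)
    ⟨_, lift_relation none 1 (map_one π)⟩
    (fun l i => ⟨_, lift_relation (some (l, i)) _ (by rw [map_mul, π_indet, π_e]; rfl)⟩)
    (f (.inl ()))
  simp only [RingHom.mem_ker, map_sub, sub_eq_zero, π_d, map_sum, map_mul, π_renameVars, π_e,
    ← Algebra.smul_def] at hH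
  rw [hH]
  exact sum_mem fun j _ => Submodule.smul_mem _ _ (Submodule.subset_span ⟨j, rfl⟩)

end AnalyticStructure

end Nakayama

namespace AnalyticStructure

section Reduction

lemma Extends.map_structMap {A R R' : Type*} [CommRing A] {𝔬 : Ideal A} [CommRing R] [CommRing R']
    [Algebra R R'] {S' : AnalyticStructure 𝔬 R'} {S : AnalyticStructure 𝔬 R} (h : S'.Extends S) :
    𝔬.map S'.structMap = (𝔬.map S.structMap).map (algebraMap R R') := by
  rw [Ideal.map_map, show (algebraMap R R').comp S.structMap = S'.structMap from
    RingHom.ext h.algebraMap_structMap]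

lemma coe_aeval_seriesX {A R : Type*} [CommRing A] {𝔬 : Ideal A} [CommRing R]
    (S : AnalyticStructure 𝔬 R) {n : ℕ} (p : MvPolynomial (Fin n) R) :
    (MvPolynomial.aeval S.seriesX p : MvPowerSeries (Fin n) R) = p :=
  coe_aeval_of_coe_eq_X (series.coe_algebraMap S) (fun _ => rfl) p

variable {A R : Type*} [CommRing A] [IsNoetherianRing A] {𝔬 : Ideal A} [IsAdicComplete 𝔬 A]
  [CommRing R] {S : AnalyticStructure 𝔬 R} {n : ℕ}

variable (S) in
lemma evalAt_aeval_indet {N : ℕ} (b : Fin N → R) (p : MvPolynomial (Fin N) A) :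
    S.evalAt b (MvPolynomial.aeval (indet 𝔬) p) = p.eval₂ S.structMap b := by
  rw [MvPolynomial.aeval_def, MvPolynomial.hom_eval₂]
  congr 1
  · exact RingHom.ext (S.evalAt_algebraMap b)
  · exact funext (S.evalAt_indet b)

lemma exists_sub_aeval_seriesX_mem (g : S.series n) : ∃ p : MvPolynomial (Fin n) R,
    g - MvPolynomial.aeval S.seriesX p ∈ (𝔬.map S.structMap).map (algebraMap R (S.series n)) := by
  obtain ⟨m, x, f, rfl⟩ := S.exists_spec_eq g
  obtain ⟨p, hp⟩ := exists_sub_aeval_indet_mem f 1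
  rw [pow_one] at hp
  let z := Fin.append (fun i => algebraMap R (S.series n) (x i)) S.seriesX
  let z' : Fin (m + n) → MvPolynomial (Fin n) R :=
    Fin.append (fun i => MvPolynomial.C (x i)) MvPolynomial.X
  have aeval_z' (i) : MvPolynomial.aeval S.seriesX (z' i) = z i := by
    refine i.addCases (fun i => ?_) fun l => ?_ <;> simp [z, z']
  refine ⟨p.eval₂ (MvPolynomial.C.comp S.structMap) z', ?_⟩
  have := (S.onSeries n).evalAt_mem_map_structMap z hp
  rw [map_sub, S.onSeries_evalAt_append_seriesX, evalAt_aeval_indet,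
    (S.onSeries_extends n).map_structMap] at this
  have aeval_comp : (algebraMap R (S.series n)).comp S.structMap = (S.onSeries n).structMap :=
    RingHom.ext (S.onSeries_extends n).algebraMap_structMap
  rwa [MvPolynomial.aeval_def, ← MvPolynomial.coe_eval₂Hom, MvPolynomial.hom_eval₂,
    ← RingHom.comp_assoc, MvPolynomial.eval₂Hom_comp_C, aeval_comp, MvPolynomial.coe_eval₂Hom,
    show (fun i => MvPolynomial.eval₂ _ S.seriesX (z' i)) = z from funext aeval_z']

lemma exists_coe_eq_map {B : Type*} [CommRing B] {φ : R →+* B}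
    (hφ : 𝔬.map S.structMap ≤ RingHom.ker φ) (g : S.series n) :
    ∃ p : MvPolynomial (Fin n) B, (p : MvPowerSeries (Fin n) B) = MvPowerSeries.map φ g.1 := by
  obtain ⟨p, hp⟩ := S.exists_sub_aeval_seriesX_mem g
  refine ⟨MvPolynomial.map φ p, ?_⟩
  ext ν
  have := hφ (coeff_mem_of_mem_map_algebraMap (series.coe_algebraMap S) hp ν)
  rw [AddSubgroupClass.coe_sub, map_sub, coe_aeval_seriesX, MvPolynomial.coeff_coe,
    RingHom.mem_ker, map_sub, sub_eq_zero] at this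
  rw [MvPolynomial.coeff_coe, MvPolynomial.coeff_map, coeff_map, this]

variable {B : Type*} [CommRing B] [Algebra R B]

/-- The reduction `R⟨Y⟩ → B[Y]` of coefficients in an `R`-algebra `B` in which `𝔬` vanishes. -/
noncomputable def red (h : 𝔬.map S.structMap ≤ RingHom.ker (algebraMap R B)) :
    S.series n →ₐ[R] MvPolynomial (Fin n) B where
  toFun g := (exists_coe_eq_map h g).choose
  map_one' := MvPolynomial.coe_injective _ _ <| by
    rw [(exists_coe_eq_map h _).choose_spec, OneMemClass.coe_one, map_one, MvPolynomial.coe_one]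
  map_mul' f g := MvPolynomial.coe_injective _ _ <| by
    rw [(exists_coe_eq_map h _).choose_spec, MvPolynomial.coe_mul,
      (exists_coe_eq_map h f).choose_spec, (exists_coe_eq_map h g).choose_spec, Subring.coe_mul,
      map_mul]
  map_zero' := MvPolynomial.coe_injective _ _ <| by
    rw [(exists_coe_eq_map h _).choose_spec, ZeroMemClass.coe_zero, map_zero,
      MvPolynomial.coe_zero]
  map_add' f g := MvPolynomial.coe_injective _ _ <| by
    rw [(exists_coe_eq_map h _).choose_spec, MvPolynomial.coe_add,
      (exists_coe_eq_map h f).choose_spec, (exists_coe_eq_map h g).choose_spec, Subring.coe_add,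
      map_add]
  commutes' a := MvPolynomial.coe_injective _ _ <| by
    rw [(exists_coe_eq_map h _).choose_spec, series.coe_algebraMap, map_C,
      MvPolynomial.algebraMap_apply, MvPolynomial.coe_C]

variable (h : 𝔬.map S.structMap ≤ RingHom.ker (algebraMap R B))

lemma coeff_red (g : S.series n) (ν : Fin n →₀ ℕ) :
    (red h g).coeff ν = algebraMap R B (coeff ν g.1) := by
  rw [← coeff_map, ← (exists_coe_eq_map h g).choose_spec, MvPolynomial.coeff_coe]
  rfl

lemma red_aeval_seriesX (p : MvPolynomial (Fin n) R) :
    red h (MvPolynomial.aeval S.seriesX p) = p.map (algebraMap R B) := by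
  ext ν
  rw [coeff_red, coe_aeval_seriesX, MvPolynomial.coeff_coe, MvPolynomial.coeff_map]

lemma red_surjective (hB : Function.Surjective (algebraMap R B)) :
    Function.Surjective (red h (n := n)) := fun p => by
  obtain ⟨p, rfl⟩ := MvPolynomial.map_surjective _ hB p
  exact ⟨_, red_aeval_seriesX h p⟩

lemma ker_red : RingHom.ker (red h (n := n)) =
    (RingHom.ker (algebraMap R B)).map (algebraMap R (S.series n)) := by
  have le_ker : (RingHom.ker (algebraMap R B)).map (algebraMap R (S.series n)) ≤
      RingHom.ker (red h (n := n)) := Ideal.map_le_iff_le_comap.2 fun a ha => by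
    rw [Ideal.mem_comap, RingHom.mem_ker, AlgHom.commutes, MvPolynomial.algebraMap_apply,
      RingHom.mem_ker.1 ha, map_zero]
  refine le_antisymm (fun g hg => ?_) le_ker
  obtain ⟨p, hp⟩ := S.exists_sub_aeval_seriesX_mem g
  replace hp := Ideal.map_mono h hp
  have p_mem : p ∈ (RingHom.ker (algebraMap R B)).map MvPolynomial.C := by
    have := sub_mem hg (le_ker hp)
    rwa [sub_sub_cancel, RingHom.mem_ker, red_aeval_seriesX, ← RingHom.mem_ker,
      MvPolynomial.ker_map] at this
  have aeval_p_mem := Ideal.mem_map_of_mem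
    (MvPolynomial.eval₂Hom (algebraMap R (S.series n)) S.seriesX) p_mem
  rw [Ideal.map_map, MvPolynomial.eval₂Hom_comp_C] at aeval_p_mem
  exact sub_add_cancel g (MvPolynomial.aeval S.seriesX p) ▸ add_mem hp aeval_p_mem

end Reduction

section Scaling

variable {A R : Type*} [CommRing A] [IsNoetherianRing A] {𝔬 : Ideal A} [IsAdicComplete 𝔬 A]
  [CommRing R] {S : AnalyticStructure 𝔬 R} {n : ℕ}

lemma mem_span_range_algebraMap_coeff (g : S.series n) :
    g ∈ Ideal.span (Set.range fun ν => algebraMap R (S.series n) (coeff ν g.1)) := by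
  obtain ⟨m, x, f, rfl⟩ := S.exists_spec_eq g
  have := Ideal.mem_map_of_mem (S.spec x) (mem_span_range_slice f)
  rw [Ideal.map_span, ← Set.range_comp] at this
  simpa only [Function.comp_def, spec_renameVars_castAdd, evalAt_slice_eq_coeff_spec] using this

lemma exists_eq_smul_coeff_eq_one [IsDomain R] [ValuationRing R] {g : S.series n} (hg : g ≠ 0) :
    ∃ (c : R) (g' : S.series n) (ν : Fin n →₀ ℕ), g = c • g' ∧ coeff ν g'.1 = 1 := by
  obtain ⟨u, hu⟩ := Finsupp.mem_ideal_span_range_iff_exists_finsupp.1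
    (mem_span_range_algebraMap_coeff g)
  obtain ⟨ν₀, hν₀⟩ := Directed.finset_le (r := fun a b : R => b ∣ a) (ι := Fin n →₀ ℕ)
    (f := fun ν => coeff ν g.1) (fun ν μ => by
      rcases ValuationRing.dvd_total (coeff ν g.1) (coeff μ g.1) with h | h
      exacts [⟨ν, dvd_rfl, h⟩, ⟨μ, h, dvd_rfl⟩]) u.support
  choose! w hw using hν₀
  have g_eq : g = coeff ν₀ g.1 • ∑ ν ∈ u.support, u ν * algebraMap R (S.series n) (w ν) := by
    conv_lhs => rw [← hu]
    rw [Finsupp.sum, Finset.smul_sum]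
    refine Finset.sum_congr rfl fun ν hν => ?_
    rw [hw ν hν, map_mul, Algebra.smul_def]
    ring
  refine ⟨_, _, ν₀, g_eq, ?_⟩
  have coeff_ne_zero : coeff ν₀ g.1 ≠ 0 := fun h => hg (by rw [g_eq, h, zero_smul])
  have := congrArg (fun g : S.series n => coeff ν₀ g.1) g_eq
  rw [Algebra.smul_def] at this
  simp only [Subring.coe_mul, series.coe_algebraMap, coeff_C_mul] at this
  exact mul_left_cancel₀ coeff_ne_zero (this.symm.trans (mul_one _).symm)

end Scaling

end AnalyticStructure

section Polynomial

variable {k σ Q : Type*} [Field k] [Finite σ] [CommRing Q] [Algebra k Q]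
  {γ π : MvPolynomial σ k →ₐ[k] Q}

lemma injective_of_surjective_of_isDomain [IsDomain Q] (hγ : Function.Injective γ)
    (hπ : Function.Surjective π) : Function.Injective π := by
  have adjoin_eq_top : Algebra.adjoin k (Set.range (π ∘ MvPolynomial.X)) = ⊤ := by
    rw [Set.range_comp, ← AlgHom.map_adjoin, MvPolynomial.adjoin_range_X, Algebra.map_top,
      (AlgHom.range_eq_top π).2 hπ]
  have : Algebra.IsAlgebraic (Algebra.adjoin k (Set.range (π ∘ MvPolynomial.X))) Q := by
    rw [adjoin_eq_top]
    exact ⟨fun z => isAlgebraic_algebraMap (⟨z, trivial⟩ : (⊤ : Subalgebra k Q))⟩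
  have indep : AlgebraicIndependent k (γ ∘ MvPolynomial.X) :=
    (MvPolynomial.algebraicIndependent_X σ k).map' hγ
  have := (Algebra.IsAlgebraic.isTranscendenceBasis_of_lift_le_trdeg_of_finite k
    (π ∘ MvPolynomial.X) indep.lift_cardinalMk_le_trdeg).1
  rwa [AlgebraicIndependent, MvPolynomial.aeval_unique π |>.symm] at this

lemma injective_of_surjective (hγ : Function.Injective γ) (hπ : Function.Surjective π) :
    Function.Injective π := by
  obtain ⟨P, hP, comap_eq⟩ := Ideal.exists_comap_eq_of_mem_minimalPrimes_of_injective
    (f := γ.toRingHom) hγ ⊥ (by simp [IsDomain.minimalPrimes_eq_singleton_bot])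
  let q : Q →ₐ[k] Q ⧸ P := Ideal.Quotient.mkₐ k P
  refine Function.Injective.of_comp (f := q) (injective_of_surjective_of_isDomain (γ := q.comp γ)
    (π := q.comp π) ((injective_iff_map_eq_zero _).2 fun f hf => ?_)
    (Ideal.Quotient.mk_surjective.comp hπ))
  have : γ f ∈ P := Ideal.Quotient.eq_zero_iff_mem.1 hf
  exact comap_eq.le this

lemma finite_of_isIntegral_of_finiteType {τ : Type*} [Algebra.FiniteType k Q]
    {γ : MvPolynomial τ k →ₐ[k] Q} (hγ : γ.toRingHom.IsIntegral) : γ.toRingHom.Finite := by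
  refine hγ.to_finite (RingHom.FiniteType.of_comp_finiteType (f := algebraMap k _) ?_)
  rw [show γ.toRingHom.comp (algebraMap k _) = algebraMap k Q from γ.comp_algebraMap]
  exact RingHom.finiteType_algebraMap.2 inferInstance

end Polynomial

namespace AnalyticStructure

section NoetherNormalization

variable {A R : Type*} [CommRing A] [IsNoetherianRing A] {𝔬 : Ideal A} [IsAdicComplete 𝔬 A]
  [CommRing R] {S : AnalyticStructure 𝔬 R} {n : ℕ}

lemma Extends.finite_of_finite_quotient {C D : Type*} [CommRing C] [CommRing D] [Algebra C D]
    {T : AnalyticStructure 𝔬 C} {T' : AnalyticStructure 𝔬 D} (hT : T'.Extends T)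
    {y : Fin n → D} (hy : Function.Surjective (hT.seriesLift y))
    (h : ((Ideal.Quotient.mk (𝔬.map T'.structMap)).comp (algebraMap C D)).Finite) :
    (algebraMap C D).Finite := by
  have : Module.Finite C (D ⧸ 𝔬.map T'.structMap) := RingHom.finite_algebraMap.1 h
  obtain ⟨N, e, he⟩ := Module.Finite.exists_fin (R := C) (M := D ⧸ 𝔬.map T'.structMap)
  choose e' he' using fun j => Ideal.Quotient.mk_surjective (e j)
  refine RingHom.finite_algebraMap.2 ⟨Submodule.fg_def.2 ⟨_, Set.finite_range e',
    hT.span_range_eq_top hy ?_⟩⟩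
  let q := (Ideal.Quotient.mkₐ C (𝔬.map T'.structMap)).toLinearMap
  have ker_q : q.ker = (𝔬.map T'.structMap).restrictScalars C :=
    SetLike.ext fun _ => Ideal.Quotient.eq_zero_iff_mem
  rw [← ker_q, ← Submodule.comap_map_eq, Submodule.map_span, ← Set.range_comp,
    show q ∘ e' = e from funext he', he, Submodule.comap_top]

lemma seriesLift_mk_seriesX_surjective {I : Ideal (S.series n)} {C : Type*} [CommRing C]
    [Algebra R C] [Algebra C (S.series n ⧸ I)] [IsScalarTower R C (S.series n ⧸ I)]
    {T : AnalyticStructure 𝔬 C} (hT : ((S.onSeries n).quotient I).Extends T) :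
    Function.Surjective (hT.seriesLift fun i => Ideal.Quotient.mk I (S.seriesX i)) := fun d => by
  obtain ⟨g, rfl⟩ := Ideal.Quotient.mk_surjective d
  obtain ⟨m, x, f, rfl⟩ := S.exists_spec_eq g
  refine ⟨T.spec (fun i => algebraMap R C (x i)) f, ?_⟩
  rw [Extends.seriesLift_spec, ← onSeries_evalAt_append_seriesX, ← quotient_evalAt_mk]
  congr 1
  refine congrArg _ (funext fun i => ?_)
  refine i.addCases (fun i => ?_) fun i => ?_
  · simp only [Fin.append_left, ← IsScalarTower.algebraMap_apply]
    rfl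
  · simp only [Fin.append_right]

lemma seriesAlgHom_ext {B : Type*} [CommRing B] [Algebra R B]
    (h : 𝔬.map S.structMap ≤ RingHom.ker (algebraMap R B)) {φ ψ : S.series n →ₐ[R] B}
    (hX : ∀ i, φ (S.seriesX i) = ψ (S.seriesX i)) : φ = ψ := by
  ext g
  obtain ⟨p, hp⟩ := S.exists_sub_aeval_seriesX_mem g
  have map_eq_zero (χ : S.series n →ₐ[R] B) : χ (g - MvPolynomial.aeval S.seriesX p) = 0 := by
    refine (Ideal.map_le_iff_le_comap (K := RingHom.ker χ)).2 (fun a ha => ?_) hp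
    rw [Ideal.mem_comap, RingHom.mem_ker, AlgHom.commutes]
    exact h ha
  have comp_eq : φ.comp (MvPolynomial.aeval S.seriesX) = ψ.comp (MvPolynomial.aeval S.seriesX) :=
    MvPolynomial.algHom_ext fun i => by simpa using hX i
  rw [← sub_add_cancel g (MvPolynomial.aeval S.seriesX p), map_add, map_add, map_eq_zero,
    map_eq_zero]
  exact congrArg (0 + ·) (DFunLike.congr_fun comp_eq p)

section QuotientRed

variable {B : Type*} [CommRing B] [Algebra R B]

/-- The reduction of `R⟨Y⟩ ⧸ I` modulo `𝔬`, for an ideal `I` of `R⟨Y⟩`. -/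
noncomputable def quotientRed (h : 𝔬.map S.structMap ≤ RingHom.ker (algebraMap R B))
    (I : Ideal (S.series n)) :
    S.series n ⧸ I →ₐ[R] MvPolynomial (Fin n) B ⧸ I.map (red h) :=
  Ideal.quotientMapₐ (I.map (red h)) (red h) Ideal.le_comap_map

variable (hB : Function.Surjective (algebraMap R B))
  (h : 𝔬.map S.structMap = RingHom.ker (algebraMap R B)) (I : Ideal (S.series n))

include hB in
lemma quotientRed_surjective : Function.Surjective (quotientRed h.le I) :=
  Ideal.quotientMap_surjective (H := Ideal.le_comap_map) (red_surjective h.le hB)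

lemma map_structMap_quotient : 𝔬.map ((S.onSeries n).quotient I).structMap =
    (RingHom.ker (red h.le)).map (Ideal.Quotient.mk I) := by
  rw [((S.onSeries_extends n).quotient I).map_structMap, ker_red, h, Ideal.map_map]
  rfl

include hB in
lemma ker_quotientRed : RingHom.ker (quotientRed h.le I) =
    𝔬.map ((S.onSeries n).quotient I).structMap := by
  rw [map_structMap_quotient h]
  ext d
  obtain ⟨g, rfl⟩ := Ideal.Quotient.mk_surjective d
  have mem_ker : Ideal.Quotient.mk I g ∈ RingHom.ker (quotientRed h.le I) ↔
      red h.le g ∈ I.map (red h.le) := Ideal.Quotient.eq_zero_iff_mem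
  rw [mem_ker, ← Ideal.mem_comap, Ideal.comap_map_of_surjective' _ (red_surjective h.le hB),
    sup_comm, ← Ideal.mem_quotient_iff_mem_sup]

include hB in
lemma map_red_ne_top {I : Ideal (S.series n)} (hI : I ≠ ⊤) : I.map (red h.le) ≠ ⊤ := by
  obtain ⟨M, hM, hIM⟩ := Ideal.exists_le_maximal I hI
  have ker_le : RingHom.ker (red h.le (n := n)) ≤ M := by
    rw [ker_red, ← h, ← (S.onSeries_extends n).map_structMap]
    exact (S.onSeries n).map_structMap_le_jacobson_bot.trans (sInf_le ⟨bot_le, hM⟩)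
  intro map_eq_top
  have := Ideal.comap_map_of_surjective' _ (red_surjective h.le hB) I
  rw [map_eq_top, Ideal.comap_top] at this
  exact hM.ne_top (top_le_iff.1 (this.le.trans (sup_le hIM ker_le)))

end QuotientRed

lemma injective_of_comp_red_injective [IsDomain R] [ValuationRing R] {k D Q : Type*} [CommRing k]
    [Nontrivial k] [Algebra R k] {h : 𝔬.map S.structMap ≤ RingHom.ker (algebraMap R k)}
    [CommRing D] [Algebra R D] [Module.IsTorsionFree R D] [Semiring Q] {Θ : S.series n →ₐ[R] D}
    {r : D →+* Q} {γ : MvPolynomial (Fin n) k →+* Q} (hγ : Function.Injective γ)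
    (comm : ∀ g, r (Θ g) = γ (red h g)) : Function.Injective Θ := by
  refine (injective_iff_map_eq_zero Θ).2 fun g hg => by_contra fun g_ne_zero => ?_
  obtain ⟨c, g', ν, rfl, coeff_eq_one⟩ := exists_eq_smul_coeff_eq_one g_ne_zero
  have c_ne_zero : c ≠ 0 := by
    rintro rfl
    exact g_ne_zero (zero_smul _ _)
  rw [map_smul, smul_eq_zero_iff_right c_ne_zero] at hg
  have red_eq_zero : red h g' = 0 := hγ (by rw [← comm, hg, map_zero, map_zero])
  have := coeff_red h g' ν
  rw [red_eq_zero, coeff_eq_one, map_one, MvPolynomial.coeff_zero] at this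
  exact zero_ne_one this

lemma exists_seriesAlgHom_quotientRed_eq {k : Type*} [Field k] [Algebra R k]
    (hk : Function.Surjective (algebraMap R k))
    (h : 𝔬.map S.structMap = RingHom.ker (algebraMap R k)) {I : Ideal (S.series n)} {s : ℕ}
    (γ : MvPolynomial (Fin s) k →ₐ[k] MvPolynomial (Fin n) k ⧸ I.map (red h.le)) :
    ∃ b : Fin s → S.series n ⧸ I, ∀ g : S.series s, quotientRed h.le I
      (((S.onSeries_extends n).quotient I).seriesLift b g) = γ (red h.le g) := by
  choose b hb using fun i => quotientRed_surjective hk h I (γ (MvPolynomial.X i))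
  refine ⟨b, fun g => ?_⟩
  refine DFunLike.congr_fun (seriesAlgHom_ext (φ := (quotientRed h.le I).comp
    (((S.onSeries_extends n).quotient I).seriesLift b))
    (ψ := (γ.restrictScalars R).comp (red h.le)) ?_ fun i => ?_) g
  · refine h.le.trans fun a ha => ?_
    rw [RingHom.mem_ker, IsScalarTower.algebraMap_apply R k, RingHom.mem_ker.1 ha, map_zero]
  · have : red h.le (S.seriesX i) = MvPolynomial.X i := by
      simpa using red_aeval_seriesX h.le (MvPolynomial.X i)
    simp [hb, this]

lemma seriesLift_finite {k : Type*} [Field k] [Algebra R k]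
    (hk : Function.Surjective (algebraMap R k))
    (h : 𝔬.map S.structMap = RingHom.ker (algebraMap R k)) {I : Ideal (S.series n)} {s : ℕ}
    {γ : MvPolynomial (Fin s) k →ₐ[k] MvPolynomial (Fin n) k ⧸ I.map (red h.le)}
    (hγ : γ.toRingHom.Finite) {b : Fin s → S.series n ⧸ I}
    (comm : ∀ g, quotientRed h.le I (((S.onSeries_extends n).quotient I).seriesLift b g) =
      γ (red h.le g)) :
    (((S.onSeries_extends n).quotient I).seriesLift b).toRingHom.Finite := by
  set Θ := ((S.onSeries_extends n).quotient I).seriesLift b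
  let _ := Θ.toAlgebra
  have : IsScalarTower R (S.series s) (S.series n ⧸ I) :=
    IsScalarTower.of_algebraMap_eq' Θ.comp_algebraMap.symm
  have hT : ((S.onSeries n).quotient I).Extends (S.onSeries s) := fun N f y =>
    (((S.onSeries_extends n).quotient I).seriesLift_evalAt b y f).symm
  refine hT.finite_of_finite_quotient (seriesLift_mk_seriesX_surjective hT) ?_
  rw [← ker_quotientRed hk h]
  let e := RingHom.quotientKerEquivOfSurjective (f := (quotientRed h.le I).toRingHom)
    (quotientRed_surjective hk h I)
  have eq_comp : (Ideal.Quotient.mk (RingHom.ker (quotientRed h.le I))).comp Θ.toRingHom =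
      e.symm.toRingHom.comp (γ.toRingHom.comp (red h.le).toRingHom) :=
    RingHom.ext fun g => e.injective ((comm g).trans (e.apply_symm_apply _).symm)
  exact eq_comp ▸ ((RingHom.Finite.of_surjective _ e.symm.surjective).comp
    (hγ.comp (RingHom.Finite.of_surjective _ (red_surjective h.le hk))))

theorem exists_finite_injective [IsDomain R] [ValuationRing R]
    (h𝔪 : 𝔬.map S.structMap = IsLocalRing.maximalIdeal R) {I : Ideal (S.series n)} (hI : I ≠ ⊤)
    [Module.IsTorsionFree R (S.series n ⧸ I)] :
    ∃ s ≤ n, (I ≠ ⊥ → s < n) ∧ ∃ Θ : S.series s →ₐ[R] S.series n ⧸ I,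
      Function.Injective Θ ∧ Θ.toRingHom.Finite := by
  have h : 𝔬.map S.structMap = RingHom.ker (algebraMap R (IsLocalRing.ResidueField R)) :=
    h𝔪.trans IsLocalRing.ker_residue.symm
  have hk : Function.Surjective (algebraMap R (IsLocalRing.ResidueField R)) :=
    IsLocalRing.residue_surjective
  obtain ⟨s, hs, γ, hγ, γ_integral⟩ :=
    exists_integral_inj_algHom_of_quotient (I.map (red h.le)) (map_red_ne_top hk h hI)
  obtain ⟨b, comm⟩ := exists_seriesAlgHom_quotientRed_eq hk h γ
  refine ⟨s, hs, fun hne => hs.lt_of_ne ?_, _,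
    injective_of_comp_red_injective (r := (quotientRed h.le I).toRingHom) (γ := γ.toRingHom)
      (h := h.le) hγ comm,
    seriesLift_finite hk h (finite_of_isIntegral_of_finiteType γ_integral) comm⟩
  rintro rfl
  have mk_injective := injective_of_surjective hγ
    (Ideal.Quotient.mkₐ_surjective (IsLocalRing.ResidueField R) (I.map (red h.le)))
  have := injective_of_comp_red_injective (Θ := Ideal.Quotient.mkₐ R I)
    (r := (quotientRed h.le I).toRingHom) (γ := Ideal.Quotient.mk (I.map (red h.le))) (h := h.le)
      mk_injective fun g => rfl
  exact hne (by rw [← Ideal.mk_ker (I := I)]; exact (RingHom.injective_iff_ker_eq_bot _).1 this)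

end NoetherNormalization

end AnalyticStructure

section Localization

variable {R Rₚ B Bₚ C Cₚ : Type*} [CommRing R] [CommRing Rₚ] [CommRing B] [CommRing Bₚ]
  [CommRing C] [CommRing Cₚ] [Algebra R Rₚ] [Algebra R B] [Algebra R Bₚ] [Algebra B Bₚ]
  [IsScalarTower R B Bₚ] [Algebra R C] [Algebra R Cₚ] [Algebra C Cₚ] [IsScalarTower R C Cₚ]
  [Algebra Rₚ Bₚ] [Algebra Rₚ Cₚ] [IsScalarTower R Rₚ Bₚ] [IsScalarTower R Rₚ Cₚ]
  (M : Submonoid R) [IsLocalization M Rₚ] [IsLocalization (Algebra.algebraMapSubmonoid B M) Bₚ]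
  [IsLocalization (Algebra.algebraMapSubmonoid C M) Cₚ]

lemma mapₐ_finite_of_finite {Θ : B →ₐ[R] C} (hΘ : Θ.toRingHom.Finite) :
    (IsLocalization.mapₐ M Rₚ Bₚ Cₚ Θ).toRingHom.Finite := by
  let _ := Θ.toAlgebra
  let _ := ((algebraMap C Cₚ).comp Θ.toRingHom).toAlgebra
  let _ := (IsLocalization.mapₐ M Rₚ Bₚ Cₚ Θ).toAlgebra
  have : IsScalarTower B Bₚ Cₚ := IsScalarTower.of_algebraMap_eq'
    (IsLocalization.map_comp (Algebra.algebraMapSubmonoid_le_comap M Θ)).symm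
  have : IsScalarTower B C Cₚ := IsScalarTower.of_algebraMap_eq' rfl
  have : IsLocalization (Algebra.algebraMapSubmonoid C (Algebra.algebraMapSubmonoid B M)) Cₚ :=
    IsLocalization.isLocalization_algebraMapSubmonoid_map_algHom M Cₚ Θ
  have : Module.Finite B C := hΘ
  exact .of_isLocalization B C (Algebra.algebraMapSubmonoid B M)

instance isLocalization_quotient_under (I : Ideal Bₚ) :
    IsLocalization (Algebra.algebraMapSubmonoid (B ⧸ I.under B) M) (Bₚ ⧸ I) := by
  have := IsLocalization.of_surjective (Algebra.algebraMapSubmonoid B M) Bₚ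
    (Ideal.Quotient.mk (I.under B)) Ideal.Quotient.mk_surjective (Ideal.Quotient.mk I)
    Ideal.Quotient.mk_surjective rfl (by
      rw [Ideal.mk_ker, Ideal.mk_ker, IsLocalization.map_under (Algebra.algebraMapSubmonoid B M)])
  exact Algebra.algebraMapSubmonoid_map_eq M (Ideal.Quotient.mkₐ R (I.under B)) ▸ this

lemma isTorsionFree_quotient_under [IsDomain R] (K : Type*) [Field K] [Algebra R K]
    [FaithfulSMul R K] [Algebra K Bₚ] [IsScalarTower R K Bₚ] (I : Ideal Bₚ) :
    Module.IsTorsionFree R (B ⧸ I.under B) := by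
  have : Module.IsTorsionFree R (Bₚ ⧸ I) := .trans K
  exact (FaithfulSMul.algebraMap_injective (B ⧸ I.under B) (Bₚ ⧸ I)).moduleIsTorsionFree _
    fun a d => map_smul (IsScalarTower.toAlgHom R (B ⧸ I.under B) (Bₚ ⧸ I)) a d

lemma isNoetherianRing_of_ringHom_finite [IsNoetherianRing B] {φ : B →+* C} (hφ : φ.Finite) :
    IsNoetherianRing C := by
  let _ := φ.toAlgebra
  have : Module.Finite B C := hφ
  exact IsNoetherianRing.of_finite B C

lemma isField_of_ringHom_finite [IsDomain C] {φ : B →+* C} (hφ : φ.Finite)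
    (hinj : Function.Injective φ) (hC : IsField C) : IsField B := by
  let _ := φ.toAlgebra
  have : Module.Finite B C := hφ
  have : IsDomain B := hinj.isDomain φ
  exact isField_of_isIntegral_of_isField hinj hC

lemma fg_of_isNoetherianRing_quotient {I J : Ideal B} (hJ : J.FG) (hJI : J ≤ I)
    [IsNoetherianRing (B ⧸ J)] : I.FG := by
  refine Ideal.fg_of_fg_map_of_fg_inf_ker_of_surjective
    (IsNoetherian.noetherian (I.map (Ideal.Quotient.mk J))) ?_ Ideal.Quotient.mk_surjective
  rwa [Ideal.mk_ker, inf_eq_right.2 hJI]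

lemma exists_algHom_isIntegral_of_finite_quotient_under [IsDomain R] {K Ka : Type*} [Field K]
    [Algebra R K] [IsFractionRing R K] [Algebra K Bₚ] [IsScalarTower R K Bₚ] [Field Ka]
    [IsAlgClosed Ka] [Algebra K Ka] [Algebra R Ka] [IsScalarTower R K Ka]
    [IsLocalization (Algebra.algebraMapSubmonoid B (nonZeroDivisors R)) Bₚ]
    (I : Ideal Bₚ) [I.IsMaximal] [Module.Finite R (B ⧸ I.under B)] :
    ∃ Φ : Bₚ →ₐ[K] Ka, (∀ f ∈ I, Φ f = 0) ∧ ∀ b, IsIntegral R (Φ (algebraMap B Bₚ b)) := by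
  let _ := Ideal.Quotient.field I
  have : Module.Finite K (Bₚ ⧸ I) :=
    .of_isLocalization R (B ⧸ I.under B) (nonZeroDivisors R)
  let ι : Bₚ ⧸ I →ₐ[K] Ka := IsAlgClosed.lift
  refine ⟨ι.comp (Ideal.Quotient.mkₐ K I), fun f hf => ?_, fun b => ?_⟩
  · exact (congrArg ι (Ideal.Quotient.eq_zero_iff_mem.2 hf)).trans (map_zero ι)
  · exact (Algebra.IsIntegral.isIntegral (R := R) (Ideal.Quotient.mk (I.under B) b)).map
      ((ι.restrictScalars R).comp (IsScalarTower.toAlgHom R (B ⧸ I.under B) (Bₚ ⧸ I)))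

end Localization

namespace AnalyticStructure

section Fractions

variable {A R : Type*} [CommRing A] {𝔬 : Ideal A} [CommRing R] {S : AnalyticStructure 𝔬 R}

lemma algebraMap_series_zero_surjective : Function.Surjective (algebraMap R (S.series 0)) :=
  fun g => ⟨coeff 0 g.1, Subtype.ext <| by
    ext ν
    rw [Subsingleton.elim ν 0, series.coe_algebraMap, coeff_zero_C]⟩

variable [IsDomain R] {K : Type*} [Field K] [Algebra R K] [IsFractionRing R K] {n : ℕ}

noncomputable instance : Algebra (S.series n) (S.fracSeries K n) :=
  RingHom.toAlgebra <| ((MvPowerSeries.map (algebraMap R K)).comp (S.series n).subtype).codRestrict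
    (S.fracSeries K n).toSubring fun g => ⟨1, one_ne_zero, g.1, g.2, by simp⟩

lemma fracSeries.coe_algebraMap (g : S.series n) :
    (algebraMap (S.series n) (S.fracSeries K n) g : MvPowerSeries (Fin n) K) =
      MvPowerSeries.map (algebraMap R K) g.1 := rfl

instance : IsScalarTower R (S.series n) (S.fracSeries K n) :=
  IsScalarTower.of_algebraMap_eq fun a => Subtype.ext <| by
    rw [fracSeries.coe_algebraMap, series.coe_algebraMap, map_C]
    exact MvPowerSeries.algebraMap_apply

lemma algebraMap_series_fracSeries_injective :
    Function.Injective (algebraMap (S.series n) (S.fracSeries K n)) := fun _ _ h =>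
  Subtype.ext <| MvPowerSeries.ext fun ν => IsFractionRing.injective R K <| by
    simpa [fracSeries.coe_algebraMap] using congrArg (fun f : S.fracSeries K n => coeff ν f.1) h

lemma exists_eq_inv_smul_algebraMap (f : S.fracSeries K n) : ∃ (c : R) (g : S.series n),
    c ≠ 0 ∧ f = (algebraMap R K c)⁻¹ • algebraMap (S.series n) (S.fracSeries K n) g := by
  obtain ⟨f, c, hc, g, hg, rfl⟩ := f
  exact ⟨c, ⟨g, hg⟩, hc, rfl⟩

instance : IsLocalization (Algebra.algebraMapSubmonoid (S.series n) (nonZeroDivisors R))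
    (S.fracSeries K n) where
  map_units := by
    rintro ⟨_, c, hc, rfl⟩
    rw [← IsScalarTower.algebraMap_apply, IsScalarTower.algebraMap_apply R K]
    exact (IsLocalization.map_units K ⟨c, hc⟩).map _
  surj f := by
    obtain ⟨c, g, hc, rfl⟩ := exists_eq_inv_smul_algebraMap f
    refine ⟨⟨g, _, c, mem_nonZeroDivisors_of_ne_zero hc, rfl⟩, ?_⟩
    rw [← IsScalarTower.algebraMap_apply, ← Algebra.commutes, ← Algebra.smul_def,
      ← algebraMap_smul K, smul_smul,
      mul_inv_cancel₀ (by rwa [Ne, FaithfulSMul.algebraMap_eq_zero_iff]), one_smul]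
  exists_of_eq h := ⟨1, by rw [algebraMap_series_fracSeries_injective h]⟩

lemma eq_zero_of_isField_fracSeries (h : IsField (S.fracSeries K n)) : n = 0 := by
  refine of_not_not fun hn => ?_
  let l : Fin n := ⟨0, Nat.pos_of_ne_zero hn⟩
  let Y := algebraMap (S.series n) (S.fracSeries K n) (S.seriesX l)
  have coe_Y : (Y : MvPowerSeries (Fin n) K) = X l := map_X _ _
  obtain ⟨f, hf⟩ := h.mul_inv_cancel (a := Y) fun Y_eq_zero => by
    have X_eq_zero : (X l : MvPowerSeries (Fin n) K) = 0 :=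
      coe_Y.symm.trans (congrArg Subtype.val Y_eq_zero)
    simpa using congrArg (coeff (Finsupp.single l 1)) X_eq_zero
  have := congrArg (fun g : S.fracSeries K n => constantCoeff g.1) hf
  simp [coe_Y] at this

variable [IsNoetherianRing A] [IsAdicComplete 𝔬 A] [ValuationRing R]
  (h𝔪 : 𝔬.map S.structMap = IsLocalRing.maximalIdeal R)

include h𝔪

lemma exists_finite_injective_under {I : Ideal (S.fracSeries K n)} (hI : I ≠ ⊤) :
    ∃ s ≤ n, (I ≠ ⊥ → s < n) ∧ ∃ Θ : S.series s →ₐ[R] S.series n ⧸ I.under (S.series n),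
      Function.Injective Θ ∧ Θ.toRingHom.Finite := by
  have := isTorsionFree_quotient_under (R := R) (B := S.series n) K I
  obtain ⟨s, hs, hlt, hΘ⟩ := exists_finite_injective h𝔪 (I := I.under (S.series n))
    (Ideal.comap_ne_top _ hI)
  refine ⟨s, hs, fun hne => hlt fun hbot => hne ?_, hΘ⟩
  rw [← IsLocalization.map_under (Algebra.algebraMapSubmonoid (S.series n) (nonZeroDivisors R))
    (S.fracSeries K n) I, hbot, Ideal.map_bot]

theorem exists_finite_injective_fracSeries {I : Ideal (S.fracSeries K n)} (hI : I ≠ ⊤) :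
    ∃ s ≤ n, (I ≠ ⊥ → s < n) ∧ ∃ φ : S.fracSeries K s →ₐ[K] S.fracSeries K n ⧸ I,
      Function.Injective φ ∧
        RingHom.Finite (A := S.fracSeries K s) (B := S.fracSeries K n ⧸ I) φ.toRingHom := by
  obtain ⟨s, hs, hlt, Θ, hΘ, hΘ_finite⟩ := exists_finite_injective_under h𝔪 hI
  refine ⟨s, hs, hlt,
    IsLocalization.mapₐ (nonZeroDivisors R) K (S.fracSeries K s) (S.fracSeries K n ⧸ I) Θ, ?_, ?_⟩
  · exact IsLocalization.mapₐ_injective_of_injective _ _ _ _ Θ hΘ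
  · exact mapₐ_finite_of_finite (nonZeroDivisors R) (Rₚ := K) (Bₚ := S.fracSeries K s)
      (Cₚ := S.fracSeries K n ⧸ I) hΘ_finite

theorem isNoetherianRing_fracSeries : IsNoetherianRing (S.fracSeries K n) := by
  induction n using Nat.strong_induction_on with
  | _ n ih =>
    refine (isNoetherianRing_iff_ideal_fg _).2 fun I => ?_
    obtain rfl | hI := eq_or_ne I ⊥
    · exact Submodule.fg_bot
    obtain ⟨f, hf, f_ne_zero⟩ := Submodule.exists_mem_ne_zero_of_ne_bot hI
    have span_le : Ideal.span {f} ≤ I := (Ideal.span_singleton_le_iff_mem I).2 hf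
    obtain hf_top | hf_top := eq_or_ne (Ideal.span {f}) ⊤
    · exact (top_le_iff.1 (hf_top.ge.trans span_le)) ▸ Ideal.fg_top _
    obtain ⟨s, -, hlt, φ, -, hφ⟩ := exists_finite_injective_fracSeries h𝔪 hf_top
    have := ih s (hlt (by simpa using f_ne_zero))
    have := isNoetherianRing_of_ringHom_finite hφ
    exact fg_of_isNoetherianRing_quotient ⟨{f}, by simp⟩ span_le

theorem finite_quotient_under_of_isMaximal (M : Ideal (S.fracSeries K n)) [hM : M.IsMaximal] :
    Module.Finite R (S.series n ⧸ M.under (S.series n)) := by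
  obtain ⟨s, -, -, Θ, hΘ, hΘ_finite⟩ := exists_finite_injective_under h𝔪 hM.ne_top
  obtain rfl : s = 0 := eq_zero_of_isField_fracSeries <| isField_of_ringHom_finite
    (mapₐ_finite_of_finite (nonZeroDivisors R) (Rₚ := K) (Bₚ := S.fracSeries K s)
      (Cₚ := S.fracSeries K n ⧸ M) hΘ_finite)
    (IsLocalization.mapₐ_injective_of_injective _ _ _ _ Θ hΘ)
    ((Ideal.Quotient.maximal_ideal_iff_isField_quotient M).1 hM)
  rw [← RingHom.finite_algebraMap, ← Θ.comp_algebraMap]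
  exact hΘ_finite.comp (.of_surjective _ algebraMap_series_zero_surjective)

end Fractions

section Integral

variable {A : Type*} [CommRing A] [IsNoetherianRing A] {𝔬 : Ideal A} [IsAdicComplete 𝔬 A]
  {R : Type*} [CommRing R] {S : AnalyticStructure 𝔬 R} {n : ℕ}

lemma adjoin_mk_seriesX_eq_top {I : Ideal (S.series n)}
    (hint : ∀ i, IsIntegral R (Ideal.Quotient.mk I (S.seriesX i))) :
    Algebra.adjoin R (Set.range fun i => Ideal.Quotient.mk I (S.seriesX i)) = ⊤ := by
  obtain ⟨N, e, he⟩ := Submodule.fg_iff_exists_fin_generating_family.1 (fg_adjoin_of_finite (R := R)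
    (Set.finite_range fun i => Ideal.Quotient.mk I (S.seriesX i)) (Set.forall_mem_range.2 hint))
  have hT := (S.onSeries_extends n).quotient I
  rw [← Algebra.toSubmodule_eq_top, ← he]
  refine hT.span_range_eq_top (seriesLift_mk_seriesX_surjective hT) (eq_top_iff.2 fun d _ => ?_)
  obtain ⟨g, rfl⟩ := Ideal.Quotient.mk_surjective d
  obtain ⟨p, hp⟩ := S.exists_sub_aeval_seriesX_mem g
  rw [← add_sub_cancel (MvPolynomial.aeval S.seriesX p) g, map_add]
  refine Submodule.add_mem_sup ?_ ?_
  · rw [he, Subalgebra.mem_toSubmodule, Algebra.adjoin_range_eq_range_aeval]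
    exact ⟨p, (MvPolynomial.comp_aeval_apply _ (Ideal.Quotient.mkₐ R I) p).symm⟩
  · rw [Submodule.restrictScalars_mem, hT.map_structMap,
      IsScalarTower.algebraMap_eq R (S.series n) (S.series n ⧸ I), ← Ideal.map_map]
    exact Ideal.mem_map_of_mem _ hp

theorem seriesAlgHom_ext_of_isIntegral {B : Type*} [CommRing B] [Algebra R B]
    {φ ψ : S.series n →ₐ[R] B} (hX : ∀ i, φ (S.seriesX i) = ψ (S.seriesX i))
    (hint : ∀ i, IsIntegral R (φ (S.seriesX i))) : φ = ψ := by
  let I := RingHom.ker φ ⊓ RingHom.ker ψ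
  have mk_isIntegral (i : Fin n) : IsIntegral R (Ideal.Quotient.mk I (S.seriesX i)) := by
    obtain ⟨p, hp, h⟩ := hint i
    refine ⟨p, hp, ?_⟩
    have aeval_mem : Polynomial.aeval (S.seriesX i) p ∈ I := by
      constructor
      · rwa [SetLike.mem_coe, RingHom.mem_ker, ← Polynomial.aeval_algHom_apply]
      · rwa [SetLike.mem_coe, RingHom.mem_ker, ← Polynomial.aeval_algHom_apply, ← hX]
    exact (Polynomial.aeval_algHom_apply (Ideal.Quotient.mkₐ R I) _ p).trans
      (Ideal.Quotient.eq_zero_iff_mem.2 aeval_mem)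
  have lift_eq : Ideal.Quotient.liftₐ I φ (fun _ h => h.1) =
      Ideal.Quotient.liftₐ I ψ (fun _ h => h.2) :=
    AlgHom.ext_of_adjoin_eq_top (adjoin_mk_seriesX_eq_top mk_isIntegral) <| by
      rintro _ ⟨i, rfl⟩
      exact hX i
  exact AlgHom.ext fun g => DFunLike.congr_fun lift_eq (Ideal.Quotient.mk I g)

end Integral

section Values

variable {A : Type*} [CommRing A] {𝔬 : Ideal A} {R Ra : Type*} [CommRing R] [CommRing Ra]
  [Algebra R Ra] {S : AnalyticStructure 𝔬 R} {Sa : AnalyticStructure 𝔬 Ra} {m n : ℕ}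

lemma extends_self (S : AnalyticStructure 𝔬 R) : S.Extends S := fun _ _ _ => rfl

lemma Extends.map_spec (hSa : Sa.Extends S) (x : Fin m → R) (f : restricted 𝔬 (m + n)) :
    MvPowerSeries.map (algebraMap R Ra) (S.spec x f).1 =
      (Sa.spec (fun i => algebraMap R Ra (x i)) f).1 := by
  ext ν
  rw [coeff_map, ← evalAt_slice_eq_coeff_spec, ← evalAt_slice_eq_coeff_spec, hSa.evalAt_algebraMap]

variable [IsNoetherianRing A] [IsAdicComplete 𝔬 A] {K Ka : Type*} [Field K] [Algebra R K]
  [IsFractionRing R K] [Field Ka] [Algebra Ra Ka] [IsFractionRing Ra Ka]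

lemma hasValueAt_inv_smul_map_iff {c : R} (hc : c ≠ 0) {g : S.series n} {y : Fin n → R} {z : K} :
    S.HasValueAt ((algebraMap R K c)⁻¹ • MvPowerSeries.map (algebraMap R K) g.1) y z ↔
      z = (algebraMap R K c)⁻¹ * algebraMap R K (S.extends_self.seriesLift y g) := by
  have map_ne_zero {b : R} (hb : b ≠ 0) : algebraMap R K b ≠ 0 := by
    rwa [Ne, FaithfulSMul.algebraMap_eq_zero_iff]
  constructor
  · rintro ⟨b, hb, m, f, x, h, rfl⟩
    have mul_eq : algebraMap R (S.series n) b * g = algebraMap R (S.series n) c * S.spec x f :=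
      Subtype.ext <| MvPowerSeries.ext fun ν => IsFractionRing.injective R K <| by
        have := congrArg (coeff ν) h
        rw [coeff_smul, coeff_smul, coeff_map, coeff_map, inv_mul_eq_div, inv_mul_eq_div,
          div_eq_div_iff (map_ne_zero hc) (map_ne_zero hb)] at this
        rw [MulMemClass.coe_mul, MulMemClass.coe_mul, series.coe_algebraMap, series.coe_algebraMap,
          coeff_C_mul, coeff_C_mul, map_mul, map_mul, mul_comm, this, mul_comm]
        rfl
    have := congrArg (fun g => algebraMap R K (S.extends_self.seriesLift y g)) mul_eq
    simp only [map_mul, AlgHom.commutes, Extends.seriesLift_spec, Algebra.algebraMap_self_apply]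
      at this
    rw [inv_mul_eq_div, inv_mul_eq_div, div_eq_div_iff (map_ne_zero hb) (map_ne_zero hc), mul_comm,
      mul_comm _ (algebraMap R K b), this]
    rfl
  · rintro rfl
    obtain ⟨m, x, f, rfl⟩ := S.exists_spec_eq g
    exact ⟨c, hc, m, f, x, rfl, by rw [Extends.seriesLift_spec]; rfl⟩

lemma Extends.hasValueAt_map_iff [IsDomain R] (hSa : Sa.Extends S) [Algebra K Ka] [Algebra R Ka]
    [IsScalarTower R K Ka] [IsScalarTower R Ra Ka] {Φ : S.fracSeries K n →ₐ[K] Ka} {y : Fin n → Ra}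
    (hΦ : ∀ g, Φ (algebraMap (S.series n) (S.fracSeries K n) g) =
      algebraMap Ra Ka (hSa.seriesLift y g)) (f : S.fracSeries K n) {z : Ka} :
    Sa.HasValueAt (MvPowerSeries.map (algebraMap K Ka) f.1) y z ↔ z = Φ f := by
  obtain ⟨c, g, hc, rfl⟩ := exists_eq_inv_smul_algebraMap f
  obtain ⟨m, x, f, rfl⟩ := S.exists_spec_eq g
  have algebraMap_c :
      algebraMap K Ka (algebraMap R K c) = algebraMap Ra Ka (algebraMap R Ra c) := by
    rw [← IsScalarTower.algebraMap_apply, ← IsScalarTower.algebraMap_apply]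
  have map_ne_zero : algebraMap R Ra c ≠ 0 := fun h => hc <| by
    rwa [h, map_zero, _root_.map_eq_zero, FaithfulSMul.algebraMap_eq_zero_iff] at algebraMap_c
  have map_eq : MvPowerSeries.map (algebraMap K Ka)
      ((algebraMap R K c)⁻¹ • algebraMap (S.series n) (S.fracSeries K n) (S.spec x f)).1 =
        (algebraMap Ra Ka (algebraMap R Ra c))⁻¹ •
          MvPowerSeries.map (algebraMap Ra Ka) (Sa.spec (fun i => algebraMap R Ra (x i)) f).1 := by
    rw [← hSa.map_spec, ← algebraMap_c, ← map_inv₀ (algebraMap K Ka)]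
    ext ν
    change algebraMap K Ka ((algebraMap R K c)⁻¹ * algebraMap R K (coeff ν (S.spec x f).1)) =
      algebraMap K Ka _ * algebraMap Ra Ka (algebraMap R Ra (coeff ν (S.spec x f).1))
    rw [map_mul, ← IsScalarTower.algebraMap_apply R Ra, ← IsScalarTower.algebraMap_apply R K]
  rw [map_eq, hasValueAt_inv_smul_map_iff map_ne_zero, map_smul, hΦ, Algebra.smul_def, map_inv₀,
    algebraMap_c, Extends.seriesLift_spec, Extends.seriesLift_spec]
  rfl

end Values

section Nullstellensatz

variable {A : Type*} [CommRing A] [IsNoetherianRing A] {𝔬 : Ideal A} [IsAdicComplete 𝔬 A]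
  {R : Type*} [CommRing R] [IsDomain R] [ValuationRing R] {S : AnalyticStructure 𝔬 R}
  (h𝔪 : 𝔬.map S.structMap = IsLocalRing.maximalIdeal R)
  {K : Type*} [Field K] [Algebra R K] [IsFractionRing R K] {n : ℕ}

include h𝔪

theorem exists_hasValueAt_zero {I : Ideal (S.fracSeries K n)} (hI : I ≠ ⊤) {Ra Ka : Type*}
    [CommRing Ra] [IsIntegrallyClosed Ra] [Field Ka] [IsAlgClosed Ka] [Algebra Ra Ka]
    [IsFractionRing Ra Ka] [Algebra K Ka] [Algebra R Ra] [Algebra R Ka] [IsScalarTower R K Ka]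
    [IsScalarTower R Ra Ka] {Sa : AnalyticStructure 𝔬 Ra} (hSa : Sa.Extends S) :
    ∃ y : Fin n → Ra, ∀ f ∈ I, ∀ z : Ka,
      Sa.HasValueAt (MvPowerSeries.map (algebraMap K Ka) (f : MvPowerSeries (Fin n) K)) y z ↔
        z = 0 := by
  obtain ⟨M, hM, hIM⟩ := Ideal.exists_le_maximal I hI
  have := finite_quotient_under_of_isMaximal h𝔪 M
  obtain ⟨Φ, hΦ, Φ_isIntegral⟩ := exists_algHom_isIntegral_of_finite_quotient_under (R := R)
    (B := S.series n) (K := K) (Ka := Ka) M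
  choose y hy using fun l => IsIntegrallyClosed.isIntegral_iff.1
    ((Φ_isIntegral (S.seriesX l)).tower_top (A := Ra))
  have Φ_comp :
      (Φ.restrictScalars R).comp (IsScalarTower.toAlgHom R (S.series n) (S.fracSeries K n)) =
        (IsScalarTower.toAlgHom R Ra Ka).comp (hSa.seriesLift y) :=
    seriesAlgHom_ext_of_isIntegral
      (fun l => (hy l).symm.trans (congrArg _ (hSa.seriesLift_seriesX y l).symm))
      fun l => Φ_isIntegral (S.seriesX l)
  refine ⟨y, fun f hf z => ?_⟩
  rw [hSa.hasValueAt_map_iff (DFunLike.congr_fun Φ_comp), hΦ f (hIM hf)]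

end Nullstellensatz

end AnalyticStructure

end AnalyticRing

theorem mainTheorem12_general {A : Type*} [CommRing A] [IsNoetherianRing A] {𝔬 : Ideal A}
    [IsAdicComplete 𝔬 A] {R : Type*} [CommRing R] [IsDomain R] [ValuationRing R]
    (S : AnalyticRing.AnalyticStructure 𝔬 R)
    (h𝔪 : 𝔬.map S.structMap = IsLocalRing.maximalIdeal R)
    {K : Type*} [Field K] [Algebra R K] [IsFractionRing R K] (n : ℕ) :
    IsDomain (S.fracSeries K n) ∧
    IsNoetherianRing (S.fracSeries K n) ∧
    ∀ I : Ideal (S.fracSeries K n), I ≠ ⊤ →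
      (∃ m : ℕ, m ≤ n ∧ ∃ φ : S.fracSeries K m →ₐ[K] (S.fracSeries K n ⧸ I),
        Function.Injective φ ∧
          RingHom.Finite (A := S.fracSeries K m) (B := S.fracSeries K n ⧸ I) φ.toRingHom) ∧
      ∀ (Ra : Type*) (Ka : Type*) [CommRing Ra] [IsIntegrallyClosed Ra]
        [Field Ka] [IsAlgClosed Ka] [Algebra Ra Ka] [IsFractionRing Ra Ka]
        [Algebra K Ka] [Algebra R Ra] [Algebra R Ka] [IsScalarTower R K Ka]
        [IsScalarTower R Ra Ka] (Sa : AnalyticRing.AnalyticStructure 𝔬 Ra), Sa.Extends S →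
        ∃ y : Fin n → Ra, ∀ f ∈ I, ∀ z : Ka,
          Sa.HasValueAt (MvPowerSeries.map (algebraMap K Ka) (f : MvPowerSeries (Fin n) K)) y z ↔
            z = 0 := by
  refine ⟨NoZeroDivisors.to_isDomain _, S.isNoetherianRing_fracSeries h𝔪, fun I hI => ⟨?_, ?_⟩⟩
  · obtain ⟨m, hm, -, hφ⟩ := S.exists_finite_injective_fracSeries h𝔪 hI
    exact ⟨m, hm, hφ⟩
  · intros
    exact S.exists_hasValueAt_zero h𝔪 hI ‹_›

theorem mainTheorem12 {A : Type*} [CommRing A] [IsNoetherianRing A]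
    (𝔬 : Ideal A) (h𝔬 : 𝔬 ≠ ⊤) [IsAdicComplete 𝔬 A]
    {R : Type*} [CommRing R] [IsDomain R] [ValuationRing R]
    (S : AnalyticRing.AnalyticStructure 𝔬 R) (hS : S.IsViable)
    {K : Type*} [Field K] [Algebra R K] [IsFractionRing R K] (n : ℕ) :
    IsDomain (S.fracSeries K n) ∧
    IsNoetherianRing (S.fracSeries K n) ∧
    ∀ I : Ideal (S.fracSeries K n), I ≠ ⊤ →
      (∃ m : ℕ, m ≤ n ∧ ∃ φ : S.fracSeries K m →ₐ[K] (S.fracSeries K n ⧸ I),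
        Function.Injective φ ∧ RingHom.Finite (A := S.fracSeries K m) (B := S.fracSeries K n ⧸ I) φ.toRingHom) ∧
      -- common zeros, in any algebraically closed valued field extension `Ka` of `K` whose
      -- valuation ring `Ra` carries an analytic structure extending that of `R`
      ∀ (Ra : Type*) (Ka : Type*) [CommRing Ra] [IsDomain Ra] [ValuationRing Ra]
        [Field Ka] [IsAlgClosed Ka] [Algebra Ra Ka] [IsFractionRing Ra Ka]
        [Algebra K Ka] [Algebra R Ra] [Algebra R Ka] [IsScalarTower R K Ka]
        [IsScalarTower R Ra Ka] [IsLocalHom (algebraMap R Ra)]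
        (Sa : AnalyticRing.AnalyticStructure 𝔬 Ra), Sa.Extends S →
        ∃ y : Fin n → Ra, ∀ f ∈ I, ∀ z : Ka,
          Sa.HasValueAt (MvPowerSeries.map (algebraMap K Ka) (f : MvPowerSeries (Fin n) K)) y z ↔
            z = 0 := by
  obtain ⟨isDomain, isNoetherianRing, h⟩ := mainTheorem12_general S hS.1 (K := K) n
  exact ⟨isDomain, isNoetherianRing, fun I hI => ⟨(h I hI).1, fun Ra Ka => (h I hI).2 Ra Ka⟩⟩
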